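/- **Theorem (density of simple integrands).** Let $(\Omega,\mathcal F,\mathbb P)$ be a complete probability space with a filtration $(\mathcal F_t)_{t\ge 0}$ satisfying the usual conditions, let $H$ and $G$ be real separable Hilbert spaces, $U$ a Hausdorff space whose Borel $\sigma$-algebra is standard, $\mathcal A$ a ring of Borel subsets of $U$, and $0<T<\infty$. Let $M=(M(t,A):t\ge 0,\ A\in\mathcal A)$ be a cylindrical orthogonal martingale-valued measure on $H$: for all $t$ and $A$, $M(t,A)$ is a linear map from $H$ to random variables, continuous for convergence in probability; each $(M(t,A)(h))_{t\ge0}$ is a càdlàg, mean-zero, square integrable martingale with $M(0,A)(h)=0$; for $t>0$, $A\mapsto M(t,A)(h)$ is a $\sigma$-finite $L^2$-valued measure (it is finitely additive and there are Borel sets $U_n\uparrow U$ all of whose Borel subsets lie in $\mathcal A$, such that $\sup_{A\in\mathcal B(U_n)}\mathbb E|M(t,A)(h)|^2<\infty$, $\mathbb E|M(t,A_j)(h)|^2\to0$ whenever $A_j\downarrow\emptyset$ in $\mathcal B(U_n)$, and $M(t,A\cap U_n)(h)\to M(t,A)(h)$ in $L^2$ for every $A\in\mathcal A$); and the predictable covariation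 satisfies $\langle M(A)(h),M(B)(h)\rangle=0$ for disjoint $A,B\in\mathcal A$. For $h\in H$ let $\nu_h$ be its intensity measure, i.e. the predictable $\sigma$-finite random measure on $\mathbb R_+\times U$ with $\nu_h([0,t]\times A)=\langle M(A)(h)\rangle_t$ almost surely for $t\ge0$, $A\in\mathcal A$. Assume that $(\nu_h)_{h\in H}$ has the sequential boundedness property: for every sequence $(h_n)$ dense in the unit sphere of $H$, every unit vector $h$ and every $t>0$, almost surely $\nu_h((s,t]\times A)\le\sup_n\nu_{h_n}((s,t]\times A)$ for all $0\le s<t$ and $A\in\mathcal A$. Assume also that $M$ has a unique quadratic variation $\langle\!\langle M\rangle\!\rangle$, i.e. a random measure on $\mathbb R_+\times U$ that is almost surely finite on each $[0,t]\times A$ ($A\in\mathcal A$) and is minimal, for the almost sure order, among the random measures $\zeta$ with $\nu_h\le\zeta$ almost surely for every $\|h\|=1$; and that $\sup_{A\in\mathcal A}\langle\!\langle M\rangle\!\rangle([0,T]\times A)<\infty$ almost surely. Let $\Gamma_M$ be the quadratic variation operator measure, i.e. the random $\mathcal L(H,H)$-valued measure on $[0,T]\times U$ with $(\Gamma_M(C)x,y)_H=\frac14(\nu_{x+y}(C)-\nu_{x-y}(C))$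 for all $x,y\in H$ and all measurable $C$, almost surely, and let $Q_M:\Omega\times[0,T]\times U\to\mathcal L(H,H)$ be its weakly predictable density: almost surely $(\Gamma_M(C)x,y)_H=\int_C (Q_Mx,y)_H\,d\langle\!\langle M\rangle\!\rangle$ for all $x,y,C$. Let $\mathcal P_T$ be the predictable $\sigma$-algebra on $\Omega\times[0,T]$ and let $\mu_M(C)=\mathbb E\int 1_C\,d\langle\!\langle M\rangle\!\rangle$ be the Doléans measure on $\mathcal P_T\otimes\mathcal B(U)$. Let $\Lambda^2(M,T)$ be the space of families $\Phi(\omega,t,u)$ of Hilbert–Schmidt operators from the Hilbert space $H_Q=Q^{1/2}(H)$, $Q=Q_M(\omega,t,u)$, with inner product $(Q^{-1/2}x,Q^{-1/2}y)_H$ ($Q^{-1/2}$ the pseudo-inverse), to $G$, such that $\Phi\circ Q_M^{1/2}(h)$ is $\mathcal P_T\otimes\mathcal B(U)$-measurable for every $h\in H$ and $$\|\Phi\|_{\Lambda^2(M,T)}^2=\int_{\Omega\times[0,T]\times U}\|\Phi\circ Q_M^{1/2}\|_{\mathcal{HS}(H,G)}^2\,d\mu_M<\infty .$$ (Here $Q^{1/2}$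 is the positive square root of $Q$; it is set to $0$ at the points, negligible for $\mu_M$, where $Q$ is not positive and symmetric.) Let $\mathcal S(M,T)$ be the set of simple integrands $$\Phi(\omega,r,u)=\sum_{i=1}^{n}\sum_{j=1}^{m}1_{(s_i,t_i]}(r)\,1_{F_i}(\omega)\,1_{A_j}(u)\,S_{ij},\qquad 0\le s_i\le t_i,\ F_i\in\mathcal F_{s_i},\ A_j\in\mathcal A,\ S_{ij}\in\mathcal{HS}(H,G),$$ with $S_{ij}$ restricted to $H_Q$. Then $\mathcal S(M,T)\subseteq\Lambda^2(M,T)$, and $\mathcal S(M,T)$ is dense in $\Lambda^2(M,T)$: for every $\Phi\in\Lambda^2(M,T)$ and $\varepsilon>0$ there is $\Psi\in\mathcal S(M,T)$ with $\|\Phi-\Psi\|_{\Lambda^2(M,T)}<\varepsilon$. -/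

import Mathlib

open MeasureTheory ProbabilityTheory Filter Set
open scoped NNReal ENNReal Topology RealInnerProductSpace

noncomputable section

namespace CylInt

/-! ### Hilbert-Schmidt operators -/

section HilbertSchmidt

variable {E F : Type*} [NormedAddCommGroup E] [InnerProductSpace ℝ E]
  [NormedAddCommGroup F] [InnerProductSpace ℝ F]

variable (E) in
/-- The index set of a complete orthonormal system of the Hilbert space `E`. -/
def onbIndex [CompleteSpace E] : Set E := (exists_hilbertBasis ℝ E).choose

variable (E) in
/-- A complete orthonormal system of the Hilbert space `E`. -/
def onb [CompleteSpace E] : HilbertBasis (onbIndex E) ℝ E :=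
  (exists_hilbertBasis ℝ E).choose_spec.choose

/-- The squared Hilbert-Schmidt norm `∑ ‖S eᵢ‖²` of a bounded operator, in `[0, ∞]`. By Parseval's
identity it does not depend on the complete orthonormal system `(eᵢ)`. -/
def hsNormSq [CompleteSpace E] (S : E →L[ℝ] F) : ℝ≥0∞ :=
  ∑' i : onbIndex E, ‖S (onb E i)‖ₑ ^ 2

/-- `S` is a Hilbert-Schmidt operator. -/
def IsHilbertSchmidt [CompleteSpace E] (S : E →L[ℝ] F) : Prop := hsNormSq S < ∞

end HilbertSchmidt

/-! ### The positive square root of an operator and the Hilbert space `H_Q = Q^{1/2}(H)` -/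

section Image

variable {H : Type*} [NormedAddCommGroup H] [InnerProductSpace ℝ H]

open Classical in
/-- The positive (symmetric) square root of a positive symmetric operator `Q` (it exists and is
unique on a Hilbert space); `0` if `Q` is not positive and symmetric. -/
def posSqrt (Q : H →L[ℝ] H) : H →L[ℝ] H :=
  if h : ∃ R : H →L[ℝ] H, R.IsPositive ∧ R ∘L R = Q then h.choose else 0

/-- The linear space `R(H)`. -/
def ImageSpace (R : H →L[ℝ] H) : Type _ := LinearMap.range (R : H →ₗ[ℝ] H)

variable (R : H →L[ℝ] H)

instance : AddCommGroup (ImageSpace R) :=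
  inferInstanceAs (AddCommGroup (LinearMap.range (R : H →ₗ[ℝ] H)))

instance : Module ℝ (ImageSpace R) :=
  inferInstanceAs (Module ℝ (LinearMap.range (R : H →ₗ[ℝ] H)))

/-- The orthogonal complement of the kernel of `R`. -/
abbrev coKer : Submodule ℝ H := (LinearMap.ker (R : H →ₗ[ℝ] H))ᗮ

/-- `R` as a linear map from `(ker R)ᗮ` to `R(H)`. -/
def coKerToImage : coKer R →ₗ[ℝ] ImageSpace R :=
  LinearMap.codRestrict (LinearMap.range (R : H →ₗ[ℝ] H))
    ((R : H →ₗ[ℝ] H) ∘ₗ (coKer R).subtype) (fun x => ⟨x, rfl⟩)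

variable [CompleteSpace H]

instance : CompleteSpace (LinearMap.ker (R : H →ₗ[ℝ] H)) :=
  (ContinuousLinearMap.isClosed_ker R).completeSpace_coe

instance : CompleteSpace (coKer R) :=
  (Submodule.isClosed_orthogonal _).completeSpace_coe

theorem coKerToImage_bijective : Function.Bijective (coKerToImage R) := by
  constructor
  · rw [injective_iff_map_eq_zero]
    intro x hx
    have h1 : (x : H) ∈ LinearMap.ker (R : H →ₗ[ℝ] H) := congrArg Subtype.val hx
    have h2 := (Submodule.mem_orthogonal _ _).1 x.2 _ h1
    exact Subtype.ext (inner_self_eq_zero.1 h2)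
  · rintro ⟨_, h, rfl⟩
    obtain ⟨y, hy, z, hz, rfl⟩ :=
      (LinearMap.ker (R : H →ₗ[ℝ] H)).exists_add_mem_mem_orthogonal h
    refine ⟨⟨z, hz⟩, Subtype.ext ?_⟩
    have hy' : R y = 0 := hy
    change R z = R (y + z)
    simp [hy']

/-- The pseudo-inverse `R⁻¹ : R(H) → (ker R)ᗮ`. -/
def pseudoInv : ImageSpace R ≃ₗ[ℝ] coKer R :=
  (LinearEquiv.ofBijective (coKerToImage R) (coKerToImage_bijective R)).symm

/-- The norm of `R(H)` is `‖R⁻¹ x‖`. -/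
instance : NormedAddCommGroup (ImageSpace R) :=
  NormedAddCommGroup.induced (ImageSpace R) (coKer R) (pseudoInv R).toLinearMap
    (pseudoInv R).injective

theorem norm_def (x : ImageSpace R) : ‖x‖ = ‖pseudoInv R x‖ := rfl

/-- The inner product of `R(H)` is `⟪R⁻¹ x, R⁻¹ y⟫`. -/
instance : InnerProductSpace ℝ (ImageSpace R) where
  inner x y := ⟪pseudoInv R x, pseudoInv R y⟫
  norm_smul_le c x := by
    simp only [norm_def, map_smul, norm_smul, le_refl]
  norm_sq_eq_re_inner x := by
    rw [norm_def]; exact norm_sq_eq_re_inner (𝕜 := ℝ) (pseudoInv R x)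
  conj_inner_symm x y := inner_conj_symm (𝕜 := ℝ) (pseudoInv R x) (pseudoInv R y)
  add_left x y z := by rw [map_add, inner_add_left]
  smul_left x y c := by rw [map_smul, inner_smul_left]

/-- The pseudo-inverse is an isometry of `R(H)` onto `(ker R)ᗮ`. -/
def pseudoInvIso : ImageSpace R ≃ₗᵢ[ℝ] coKer R :=
  { pseudoInv R with norm_map' := fun _ => rfl }

instance : CompleteSpace (ImageSpace R) :=
  (pseudoInvIso R).toIsometryEquiv.completeSpace

/-- The inclusion of `R(H)` into `H`. -/
def inclusion : ImageSpace R →L[ℝ] H :=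
  R ∘L (coKer R).subtypeL ∘L (pseudoInvIso R : ImageSpace R →L[ℝ] coKer R)

/-- `R` as a bounded operator from `H` to the Hilbert space `R(H)`. -/
def toImage : H →L[ℝ] ImageSpace R :=
  ((pseudoInvIso R).symm : coKer R →L[ℝ] ImageSpace R) ∘L (coKer R).orthogonalProjectionOnto

theorem inclusion_eq (x : ImageSpace R) : inclusion R x = x.1 :=
  congrArg Subtype.val
    ((LinearEquiv.ofBijective (coKerToImage R) (coKerToImage_bijective R)).apply_symm_apply x)

theorem toImage_eq (h : H) : (toImage R h).1 = R h := by
  have h1 : (toImage R h).1 = R ((coKer R).orthogonalProjectionOnto h : H) := rfl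
  have h2 : h - ((coKer R).orthogonalProjectionOnto h : H) ∈ (coKer R)ᗮ :=
    Submodule.sub_starProjection_mem_orthogonal h
  rw [Submodule.orthogonal_orthogonal] at h2
  have h3 : R (h - ((coKer R).orthogonalProjectionOnto h : H)) = 0 := h2
  rw [map_sub, sub_eq_zero] at h3
  rw [h1, ← h3]

end Image

/-! ### Real martingales and their predictable quadratic covariation -/

section Processes

variable {Ω : Type*} [mΩ : MeasurableSpace Ω]

/-- `F₀` contains all `P`-null sets and the filtration is right continuous. -/
structure UsualConditions (P : Measure Ω) (𝓕 : Filtration ℝ≥0 mΩ) : Prop where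
  rightContinuous : 𝓕.IsRightContinuous
  null_mem : ∀ s : Set Ω, P s = 0 → MeasurableSet[𝓕 0] s

/-- `m` is a càdlàg, mean-zero, square integrable martingale. -/
structure IsSquareIntegrableMartingale (P : Measure Ω) (𝓕 : Filtration ℝ≥0 mΩ)
    (m : ℝ≥0 → Ω → ℝ) : Prop where
  martingale : Martingale m 𝓕 P
  memLp : ∀ t, MemLp (m t) 2 P
  mean_zero : ∀ t, ∫ ω, m t ω ∂P = 0
  cadlag : ∀ᵐ ω ∂P, ∀ t, ContinuousWithinAt (fun r => m r ω) (Ici t) t ∧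
    ∃ l, Tendsto (fun r => m r ω) (𝓝[<] t) (𝓝 l)

/-- `V` is (a version of) the predictable quadratic covariation `⟨Y, Z⟩`: it is predictable, null
at time zero, with right-continuous paths of locally finite variation, and `Y Z - V` is a
martingale. -/
structure IsCovariation (P : Measure Ω) (𝓕 : Filtration ℝ≥0 mΩ) (Y Z V : ℝ≥0 → Ω → ℝ) : Prop where
  predictable : IsStronglyPredictable 𝓕 V
  zero : V 0 =ᵐ[P] 0
  paths : ∀ᵐ ω ∂P, (∀ t, ContinuousWithinAt (fun r => V r ω) (Ici t) t) ∧
    LocallyBoundedVariationOn (fun r => V r ω) univ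
  martingale : Martingale (Y * Z - V) 𝓕 P

end Processes

/-! ### Cylindrical orthogonal martingale-valued measures -/

section MVM

variable {Ω : Type*} [mΩ : MeasurableSpace Ω] {U : Type*} [MeasurableSpace U]
  {H : Type*} [NormedAddCommGroup H] [InnerProductSpace ℝ H]

/-- `N` is a `σ`-finite `L²`-valued measure on the ring `𝒜`. -/
structure IsL2ValuedMeasure (P : Measure Ω) (𝒜 : Set (Set U)) (N : Set U → Ω → ℝ) : Prop where
  memLp : ∀ A ∈ 𝒜, MemLp (N A) 2 P
  add : ∀ A ∈ 𝒜, ∀ B ∈ 𝒜, Disjoint A B → N (A ∪ B) =ᵐ[P] N A + N B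
  sigmaFinite : ∃ V : ℕ → Set U, (∀ n, MeasurableSet (V n)) ∧ Monotone V ∧ (⋃ n, V n) = univ ∧
    (∀ n, ∀ B ⊆ V n, MeasurableSet B → B ∈ 𝒜) ∧
    (∀ n, (⨆ B ∈ {B | B ⊆ V n ∧ MeasurableSet B}, ∫⁻ ω, ‖N B ω‖ₑ ^ 2 ∂P) < ∞) ∧
    (∀ n, ∀ A : ℕ → Set U, (∀ j, MeasurableSet (A j) ∧ A j ⊆ V n) → Antitone A →
      (⋂ j, A j) = ∅ → Tendsto (fun j => ∫⁻ ω, ‖N (A j) ω‖ₑ ^ 2 ∂P) atTop (𝓝 0)) ∧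
    (∀ A ∈ 𝒜, Tendsto (fun n => ∫⁻ ω, ‖N A ω - N (A ∩ V n) ω‖ₑ ^ 2 ∂P) atTop (𝓝 0))

/-- `M = (M(t, A) : t ≥ 0, A ∈ 𝒜)` is a cylindrical orthogonal martingale-valued measure on the
Hilbert space `H`. Here `M t A h` is the real random variable `M(t, A)(h)`. -/
structure IsCylOrthMVM (P : Measure Ω) (𝓕 : Filtration ℝ≥0 mΩ) (𝒜 : Set (Set U))
    (M : ℝ≥0 → Set U → H → Ω → ℝ) : Prop where
  linear : ∀ t, ∀ A ∈ 𝒜, ∀ (a b : ℝ) (x y : H),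
    M t A (a • x + b • y) =ᵐ[P] a • M t A x + b • M t A y
  continuous : ∀ t, ∀ A ∈ 𝒜, ∀ (x : ℕ → H) (y : H), Tendsto x atTop (𝓝 y) →
    TendstoInMeasure P (fun n => M t A (x n)) atTop (M t A y)
  zero : ∀ A ∈ 𝒜, ∀ x, M 0 A x =ᵐ[P] 0
  martingale : ∀ A ∈ 𝒜, ∀ x, IsSquareIntegrableMartingale P 𝓕 (fun t => M t A x)
  l2Measure : ∀ t, 0 < t → ∀ x, IsL2ValuedMeasure P 𝒜 (fun A => M t A x)
  orthogonal : ∀ x, ∀ A ∈ 𝒜, ∀ B ∈ 𝒜, Disjoint A B →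
    IsCovariation P 𝓕 (fun t => M t A x) (fun t => M t B x) 0

/-- The random measure `ν` is the intensity measure of `(M(t, A)(x) : t ≥ 0, A ∈ 𝒜)`: it is
predictable, `σ`-finite, and `ν([0, t] × A) = ⟨M(A)(x)⟩_t` almost surely. -/
structure IsIntensityMeasure (P : Measure Ω) (𝓕 : Filtration ℝ≥0 mΩ) (𝒜 : Set (Set U))
    (M : ℝ≥0 → Set U → H → Ω → ℝ) (x : H) (ν : Kernel Ω (ℝ≥0 × U)) : Prop where
  predictable : ∀ A, MeasurableSet A →
    Measurable[𝓕.predictable] (fun p : ℝ≥0 × Ω => ν p.2 (Icc 0 p.1 ×ˢ A))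
  sigmaFinite : ∀ᵐ ω ∂P, SigmaFinite (ν ω)
  bracket : ∀ A ∈ 𝒜, ∃ V, IsCovariation P 𝓕 (fun t => M t A x) (fun t => M t A x) V ∧
    ∀ t, ∀ᵐ ω ∂P, ν ω (Icc 0 t ×ˢ A) ≠ ∞ ∧ (ν ω (Icc 0 t ×ˢ A)).toReal = V t ω

/-- The order of random measures: `ρ(ω) ≤ ρ'(ω)` for almost every `ω`. -/
def RandomLE (P : Measure Ω) (ρ ρ' : Kernel Ω (ℝ≥0 × U)) : Prop := ∀ᵐ ω ∂P, ρ ω ≤ ρ' ω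

/-- `η` is a quadratic variation: it is finite on the sets `[0, t] × A`, and a minimal element of
the collection of all random measures that dominate the intensity measures `ν x`, `‖x‖ = 1`. -/
structure IsQuadraticVariation (P : Measure Ω) (𝒜 : Set (Set U)) (ν : H → Kernel Ω (ℝ≥0 × U))
    (η : Kernel Ω (ℝ≥0 × U)) : Prop where
  finite : ∀ t, ∀ A ∈ 𝒜, ∀ᵐ ω ∂P, η ω (Icc 0 t ×ˢ A) < ∞
  dominates : ∀ x, ‖x‖ = 1 → RandomLE P (ν x) η
  minimal : ∀ ζ : Kernel Ω (ℝ≥0 × U), (∀ x, ‖x‖ = 1 → RandomLE P (ν x) ζ) →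
    RandomLE P ζ η → RandomLE P η ζ

/-- The sequential boundedness property of the family of intensity measures. -/
def SequentiallyBounded (P : Measure Ω) (𝒜 : Set (Set U)) (ν : H → Kernel Ω (ℝ≥0 × U)) : Prop :=
  ∀ x : ℕ → H, (∀ n, ‖x n‖ = 1) → Metric.sphere (0 : H) 1 ⊆ closure (range x) →
    ∀ y : H, ‖y‖ = 1 → ∀ t : ℝ≥0, 0 < t → ∀ᵐ ω ∂P, ∀ s < t, ∀ A ∈ 𝒜,
      ν y ω (Ioc s t ×ˢ A) ≤ ⨆ n, ν (x n) ω (Ioc s t ×ˢ A)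

/-- The restriction of a measure on `[0, ∞) × U` to `[0, T] × U`. -/
def restrictTo (T : ℝ≥0) (ρ : Measure (ℝ≥0 × U)) : Measure (Icc 0 T × U) :=
  ρ.comap (Prod.map Subtype.val id)

/-- `Γ` is the quadratic variation operator measure: a random measure on `[0, T] × U` with values
in the bounded operators on `H` and
`⟪Γ(C) x, y⟫ = (ν_{x+y}(C) - ν_{x-y}(C)) / 4`. -/
def IsOperatorMeasure (P : Measure Ω) (T : ℝ≥0) (ν : H → Kernel Ω (ℝ≥0 × U))
    (Γ : Ω → VectorMeasure (Icc 0 T × U) (H →L[ℝ] H)) : Prop :=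
  ∀ x y, ∀ᵐ ω ∂P, ∀ C, MeasurableSet C →
    ⟪Γ ω C x, y⟫ = ((restrictTo T (ν (x + y) ω) C).toReal
      - (restrictTo T (ν (x - y) ω) C).toReal) / 4

/-- The `σ`-algebra `𝒫_T ⊗ ℬ(U)` on `Ω × [0, T] × U`, where `𝒫_T` is the restriction of the
predictable `σ`-algebra. -/
abbrev predictableSigma (𝓕 : Filtration ℝ≥0 mΩ) (T : ℝ≥0) (U : Type*) [mU : MeasurableSpace U] :
    MeasurableSpace (Ω × Icc 0 T × U) :=
  (𝓕.predictable.comap fun z => ((z.2.1 : ℝ≥0), z.1)) ⊔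
    mU.comap fun z => z.2.2

theorem predictableSigma_le (𝓕 : Filtration ℝ≥0 mΩ) (T : ℝ≥0) :
    predictableSigma 𝓕 T U ≤ (inferInstance : MeasurableSpace (Ω × Icc 0 T × U)) := by
  refine sup_le ?_ ?_
  · have h : 𝓕.predictable ≤ (inferInstance : MeasurableSpace (ℝ≥0 × Ω)) :=
      measurableSpace_le_predictable_of_measurableSet
        (fun A hA => (measurableSet_singleton _).prod (𝓕.le _ A hA))
        (fun i A hA => measurableSet_Ioi.prod (𝓕.le _ A hA))
    refine (MeasurableSpace.comap_mono h).trans (Measurable.comap_le ?_)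
    fun_prop
  · exact Measurable.comap_le (measurable_snd.comp measurable_snd)

/-- `Q` is the density of the operator measure `Γ` with respect to the quadratic variation `η`, a
weakly predictable process with `⟪Γ(C) x, y⟫ = ∫_C ⟪Q x, y⟫ dη`. -/
structure IsOperatorDensity (P : Measure Ω) (𝓕 : Filtration ℝ≥0 mΩ) (T : ℝ≥0)
    (η : Kernel Ω (ℝ≥0 × U)) (Γ : Ω → VectorMeasure (Icc 0 T × U) (H →L[ℝ] H))
    (Q : Ω → Icc 0 T → U → H →L[ℝ] H) : Prop where
  predictable : ∀ x y,
    Measurable[predictableSigma 𝓕 T U] (fun z : Ω × Icc 0 T × U => ⟪Q z.1 z.2.1 z.2.2 x, y⟫)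
  density : ∀ᵐ ω ∂P, ∀ x y, ∀ C, MeasurableSet C →
    IntegrableOn (fun p : Icc 0 T × U => ⟪Q ω p.1 p.2 x, y⟫) C (restrictTo T (η ω)) ∧
    ⟪Γ ω C x, y⟫ = ∫ p in C, ⟪Q ω p.1 p.2 x, y⟫ ∂(restrictTo T (η ω))

/-- The Doléans measure `μ_M(C) = E ∫ 1_C dη` on `𝒫_T ⊗ ℬ(U)`. -/
def doleans (P : Measure Ω) (𝓕 : Filtration ℝ≥0 mΩ) (T : ℝ≥0) (η : Kernel Ω (ℝ≥0 × U)) :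
    @Measure (Ω × Icc 0 T × U) (predictableSigma 𝓕 T U) :=
  (P.bind fun ω => (restrictTo T (η ω)).map (Prod.mk ω)).trim (predictableSigma_le 𝓕 T)

end MVM

/-! ### The integrands -/

section Integrands

variable {Ω : Type*} [mΩ : MeasurableSpace Ω] {U : Type*} [MeasurableSpace U]
  {H : Type*} [NormedAddCommGroup H] [InnerProductSpace ℝ H] [CompleteSpace H]
  {G : Type*} [NormedAddCommGroup G] [InnerProductSpace ℝ G]
  {T : ℝ≥0}

/-- Families `Φ(ω, t, u)` of bounded operators from `H_Q = Q^{1/2}(H)`, `Q = Q(ω, t, u)`,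
to `G`. -/
abbrev Family (Q : Ω → Icc 0 T → U → H →L[ℝ] H) (G : Type*) [NormedAddCommGroup G]
    [InnerProductSpace ℝ G] : Type _ :=
  ∀ (ω : Ω) (t : Icc 0 T) (u : U), ImageSpace (posSqrt (Q ω t u)) →L[ℝ] G

/-- The operator `Φ(ω, t, u) ∘ Q^{1/2}(ω, t, u)` from `H` to `G`, at `z = (ω, t, u)`. -/
def compSqrt {Q : Ω → Icc 0 T → U → H →L[ℝ] H} (Φ : Family Q G) (z : Ω × Icc 0 T × U) :
    H →L[ℝ] G :=
  Φ z.1 z.2.1 z.2.2 ∘L toImage (posSqrt (Q z.1 z.2.1 z.2.2))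

/-- The seminorm `(∫ ‖Φ ∘ Q^{1/2}‖²_HS dμ_M)^{1/2}`, with values in `[0, ∞]`. -/
def lambdaNorm (P : Measure Ω) (𝓕 : Filtration ℝ≥0 mΩ) (η : Kernel Ω (ℝ≥0 × U))
    {Q : Ω → Icc 0 T → U → H →L[ℝ] H} (Φ : Family Q G) : ℝ≥0∞ :=
  (∫⁻ z, hsNormSq (compSqrt Φ z) ∂(doleans P 𝓕 T η)) ^ (1 / 2 : ℝ)

/-- `Φ` belongs to `Λ²(M, T)`. -/
structure MemLambda (P : Measure Ω) (𝓕 : Filtration ℝ≥0 mΩ) (η : Kernel Ω (ℝ≥0 × U))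
    {Q : Ω → Icc 0 T → U → H →L[ℝ] H} (Φ : Family Q G) : Prop where
  hilbertSchmidt : ∀ ω t u, IsHilbertSchmidt (Φ ω t u)
  predictable : ∀ h : H,
    @Measurable _ _ (predictableSigma 𝓕 T U) (borel G) (fun z => compSqrt Φ z h)
  norm_lt : lambdaNorm P 𝓕 η Φ < ∞

/-- `Φ` belongs to `𝒮(M, T)`: it is a finite sum of the families
`1_{(s_i, t_i]}(r) 1_{F_i}(ω) 1_{A_j}(u) S_{ij}`, with `S_{ij}` restricted to `H_Q`. -/
def IsSimple (𝓕 : Filtration ℝ≥0 mΩ) (𝒜 : Set (Set U))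
    {Q : Ω → Icc 0 T → U → H →L[ℝ] H} (Φ : Family Q G) : Prop :=
  ∃ (n m : ℕ) (s t : Fin n → ℝ≥0) (F : Fin n → Set Ω) (A : Fin m → Set U)
    (S : Fin n → Fin m → H →L[ℝ] G),
    (∀ i, s i ≤ t i) ∧ (∀ i, MeasurableSet[𝓕 (s i)] (F i)) ∧ (∀ j, A j ∈ 𝒜) ∧
    (∀ i j, IsHilbertSchmidt (S i j)) ∧
    ∀ ω r u, Φ ω r u = ∑ i, ∑ j,
      ((Ioc (s i) (t i)).indicator (1 : ℝ≥0 → ℝ) r * (F i).indicator (1 : Ω → ℝ) ω *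
        (A j).indicator (1 : U → ℝ) u) • (S i j ∘L inclusion (posSqrt (Q ω r u)))

end Integrands

end CylInt

end

noncomputable section

namespace CylInt

/-! ### Hilbert-Schmidt norms -/

section HilbertSchmidtLemmas

variable {E F E' : Type*} [NormedAddCommGroup E] [InnerProductSpace ℝ E] [CompleteSpace E]
  [NormedAddCommGroup F] [InnerProductSpace ℝ F]
  [NormedAddCommGroup E'] [InnerProductSpace ℝ E'] [CompleteSpace E']

/-! Composition with Q^{1/2} maps Λ²(M,T) isometrically into the square integrable fields of
Hilbert–Schmidt operators L : H → G, and the fields obtained vanish on ker Q^{1/2}. A simple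
integrand becomes a combination of fields 1_B (S ∘ Q^{1/2}), where B is a box given by r ∈ (s,t], ω
∈ F, u ∈ A. If a field is read through its matrix entries, everything takes place in a scalar L²
space, and density reduces to this: a g orthogonal to all 1_B (S ∘ Q^{1/2}) with S of rank one is
orthogonal to every such L (`exists_simple_approx`).

Fix h in H and a basis vector b of G, and let φ be the pointwise pairing of g with (⟪h,·⟫ b) ∘
Q^{1/2}. Orthogonality says that φ has integral zero over every box, so a π-λ argument on each (0,T]
× V_n gives φ = 0 at positive times (`ae_eq_zero_of_simpleBoxes`). No box reaches time 0, but there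
Q^{1/2} h = 0 almost everywhere, because the expected intensity of {0} × A is E|M(0,A)(h)|² = 0
(`sqrtAt_eq_zero_at_zero`). With h running through a countable dense set, φ = 0 says that Q^{1/2}
x_b = 0, where x_b is the vector of entries of g with second index b. Since L kills the kernel, the
pairing of L with g is ∑_b ⟪b, L x_b⟫ = 0 (`tsum_mul_entry_eq_zero`).

Integrability comes from E ν_h([0,T] × A) = E|M(T,A)(h)|², which the closed graph theorem bounds by
a multiple of ‖h‖². This controls the energy of Q^{1/2} h (`exists_energy_bound`) and, summed over
the vectors S* b, that of S ∘ Q^{1/2}. Measurability of Q^{1/2} holds because it is a strong limit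
of polynomials in the normalized Q (`tendsto_posSqrt`). -/

theorem enorm_sq_eq_ofReal {V : Type*} [NormedAddCommGroup V] (x : V) :
    ‖x‖ₑ ^ 2 = ENNReal.ofReal (‖x‖ ^ 2) := by
  rw [ENNReal.ofReal_pow (norm_nonneg _), ofReal_norm]

omit [CompleteSpace E] in
theorem hasSum_inner_sq {ι : Type*} (b : HilbertBasis ι ℝ E) (x : E) :
    HasSum (fun i => ⟪b i, x⟫ ^ 2) (‖x‖ ^ 2) := by
  have h := b.hasSum_inner_mul_inner x x
  rw [real_inner_self_eq_norm_sq] at h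
  refine h.congr_fun fun i => ?_
  rw [real_inner_comm x, sq]

omit [CompleteSpace E] in
theorem enorm_sq_eq_tsum {ι : Type*} (b : HilbertBasis ι ℝ E) (x : E) :
    ‖x‖ₑ ^ 2 = ∑' i, ‖⟪b i, x⟫‖ₑ ^ 2 := by
  have h := hasSum_inner_sq b x
  simp_rw [enorm_sq_eq_ofReal, Real.norm_eq_abs, sq_abs]
  rw [← h.tsum_eq, ENNReal.ofReal_tsum_of_nonneg (fun _ => sq_nonneg _) h.summable]

theorem hsNormSq_smul (c : ℝ) (S : E →L[ℝ] F) : hsNormSq (c • S) = ‖c‖ₑ ^ 2 * hsNormSq S := by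
  simp only [hsNormSq, _root_.smul_apply, enorm_smul, mul_pow, ENNReal.tsum_mul_left]

theorem hsNormSq_zero : hsNormSq (0 : E →L[ℝ] F) = 0 := by simp [hsNormSq]

theorem hsNormSq_sum_le {ι : Type*} (s : Finset ι) (S : ι → E →L[ℝ] F) :
    hsNormSq (∑ k ∈ s, S k) ≤ s.card * ∑ k ∈ s, hsNormSq (S k) := by
  unfold hsNormSq
  rw [← Summable.tsum_finsetSum fun _ _ => ENNReal.summable, ← ENNReal.tsum_mul_left]
  refine ENNReal.tsum_le_tsum fun i => ?_
  rw [_root_.sum_apply]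
  have h1 : ‖∑ k ∈ s, S k (onb E i)‖₊ ^ 2 ≤ s.card * ∑ k ∈ s, ‖S k (onb E i)‖₊ ^ 2 :=
    (pow_le_pow_left₀ (zero_le) (nnnorm_sum_le s _) 2).trans sq_sum_le_card_mul_sum_sq
  simpa only [enorm_eq_nnnorm] using mod_cast h1

theorem IsHilbertSchmidt.sum {ι : Type*} {s : Finset ι} {S : ι → E →L[ℝ] F}
    (hS : ∀ k ∈ s, IsHilbertSchmidt (S k)) : IsHilbertSchmidt (∑ k ∈ s, S k) :=
  (hsNormSq_sum_le s S).trans_lt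
    (ENNReal.mul_lt_top (by simp) (ENNReal.sum_lt_top.2 hS))

theorem IsHilbertSchmidt.smul {S : E →L[ℝ] F} (hS : IsHilbertSchmidt S) (c : ℝ) :
    IsHilbertSchmidt (c • S) := by
  unfold IsHilbertSchmidt at *
  rw [hsNormSq_smul]
  exact ENNReal.mul_lt_top (by simp) hS

theorem isHilbertSchmidt_rankOne (g : F) (h : E) :
    IsHilbertSchmidt ((innerSL ℝ h).smulRight g) := by
  unfold IsHilbertSchmidt hsNormSq
  have (i : onbIndex E) : ‖(innerSL ℝ h).smulRight g (onb E i)‖ₑ ^ 2 =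
      ‖g‖ₑ ^ 2 * ‖⟪onb E i, h⟫‖ₑ ^ 2 := by
    simp [enorm_smul, mul_pow, real_inner_comm, mul_comm]
  simp_rw [this, ENNReal.tsum_mul_left, ← enorm_sq_eq_tsum]
  exact ENNReal.mul_lt_top (by simp) (by simp)

variable [CompleteSpace F]

/-- The squared Hilbert-Schmidt norm is the sum of the squares of all matrix entries. -/
theorem hsNormSq_eq_tsum_entries (S : E →L[ℝ] F) :
    hsNormSq S = ∑' k : onbIndex E × onbIndex F, ‖⟪onb F k.2, S (onb E k.1)⟫‖ₑ ^ 2 := by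
  rw [ENNReal.tsum_prod']
  exact tsum_congr fun i => enorm_sq_eq_tsum (onb F) _

open ContinuousLinearMap in
theorem hsNormSq_eq_tsum_adjoint (S : E →L[ℝ] F) :
    hsNormSq S = ∑' b : onbIndex F, ‖adjoint S (onb F b)‖ₑ ^ 2 := by
  rw [hsNormSq_eq_tsum_entries, ENNReal.tsum_prod', ENNReal.tsum_comm]
  refine tsum_congr fun b => ?_
  rw [enorm_sq_eq_tsum (onb E)]
  refine tsum_congr fun i => ?_
  rw [adjoint_inner_right, real_inner_comm]

open ContinuousLinearMap in
-- The norm is computed on adjoints: (S B)* = B* S*, so the bounded factor acts last and comes out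
-- as ‖B*‖².
theorem IsHilbertSchmidt.comp {S : E →L[ℝ] F} (hS : IsHilbertSchmidt S) (B : E' →L[ℝ] E) :
    IsHilbertSchmidt (S ∘L B) := by
  unfold IsHilbertSchmidt at *
  rw [hsNormSq_eq_tsum_adjoint] at *
  refine lt_of_le_of_lt (b := ∑' b : onbIndex F, ‖adjoint B‖ₑ ^ 2 * ‖adjoint S (onb F b)‖ₑ ^ 2)
    (ENNReal.tsum_le_tsum fun b => ?_) ?_
  · rw [adjoint_comp, ← mul_pow]
    gcongr
    exact le_opENorm _ _
  · rw [ENNReal.tsum_mul_left]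
    exact ENNReal.mul_lt_top (by simp) hS

end HilbertSchmidtLemmas

/-! ### Consequences of separability: countable orthonormal systems and weak measurability -/

section Countable

variable (E : Type*) [NormedAddCommGroup E] [InnerProductSpace ℝ E] [CompleteSpace E]
  [TopologicalSpace.SeparableSpace E]

instance countable_onbIndex : Countable (onbIndex E) := by
  have ho := (onb E).orthonormal
  -- Distinct basis vectors are at distance √2, so the balls of radius 1/2 are disjoint, and a
  -- separable space has room for only countably many.
  have hd : (univ : Set (onbIndex E)).PairwiseDisjoint fun i => Metric.ball (onb E i) (1 / 2) := by
    intro i _ j _ hij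
    refine Metric.ball_disjoint_ball ?_
    have h1 : ‖onb E i - onb E j‖ ^ 2 = 2 := by
      rw [@norm_sub_sq_real, ho.1, ho.1, ho.2 hij]; norm_num
    rw [dist_eq_norm]
    nlinarith [norm_nonneg (onb E i - onb E j)]
  have := hd.countable_of_isOpen (fun _ _ => Metric.isOpen_ball)
    (fun i _ => Metric.nonempty_ball.2 (by norm_num))
  exact countable_univ_iff.1 this

end Countable

section WeakMeasurability

variable {Z : Type*} {mZ : MeasurableSpace Z} {E : Type*} [NormedAddCommGroup E] [InnerProductSpace ℝ E]
  [CompleteSpace E] [TopologicalSpace.SeparableSpace E] [MeasurableSpace E] [BorelSpace E]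

/-- A weakly measurable function with values in a separable Hilbert space is measurable. -/
theorem measurable_of_inner {f : Z → E} (hf : ∀ y : E, Measurable fun z => ⟪y, f z⟫) :
    Measurable f := by
  have : SecondCountableTopology E := UniformSpace.secondCountable_of_separable E
  obtain hE | ⟨⟨i₀⟩⟩ := isEmpty_or_nonempty (onbIndex E)
  · have h0 (x : E) : x = 0 := by
      have := hasSum_inner_sq (onb E) x
      simpa using this.unique hasSum_empty
    rw [show f = fun _ => 0 from funext fun z => h0 _]
    exact measurable_const
  refine measurable_of_tendsto_metrizable' (atTop : Filter (Finset (onbIndex E)))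
    (f := fun s z => ∑ i ∈ s, ⟪onb E i, f z⟫ • onb E i) (fun s => ?_) ?_
  · exact Finset.measurable_sum _ fun i _ => (hf _).smul_const _
  · rw [tendsto_pi_nhds]
    intro z
    have := (onb E).hasSum_repr (f z)
    simp_rw [(onb E).repr_apply_apply] at this
    exact this

end WeakMeasurability

/-! ### Existence, uniqueness and approximation of the positive square root -/

section PolynomialCone

open Polynomial

/-- The polynomials that are combinations of the products `X ^ i * (1 - X) ^ j` with nonnegative
coefficients. -/
def unitCone : Subalgebra ℝ≥0 ℝ[X] := Algebra.adjoin ℝ≥0 {X, 1 - X}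

theorem X_mem_unitCone : (X : ℝ[X]) ∈ unitCone := Algebra.subset_adjoin (by simp)

theorem one_sub_X_mem_unitCone : (1 - X : ℝ[X]) ∈ unitCone := Algebra.subset_adjoin (by simp)

theorem C_half_mem_unitCone : (C (1 / 2) : ℝ[X]) ∈ unitCone := by
  have := unitCone.smul_mem (one_mem unitCone) (1 / 2 : ℝ≥0)
  convert this using 1
  rw [NNReal.smul_def, Polynomial.smul_eq_C_mul]
  simp

/-- Polynomials that increase to the square root on the unit interval. -/
def sqrtPoly : ℕ → ℝ[X]
  | 0 => 0
  | k + 1 => sqrtPoly k + C (1 / 2) * (X - sqrtPoly k ^ 2)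

theorem C_half_add_C_half : (C (1 / 2) : ℝ[X]) + C (1 / 2) = 1 := by
  rw [← C_add]; norm_num

theorem one_sub_sqrtPoly_succ (k : ℕ) :
    1 - sqrtPoly (k + 1) = C (1 / 2) * ((1 - X) + (1 - sqrtPoly k) * (1 - sqrtPoly k)) := by
  rw [sqrtPoly]
  linear_combination (-1 + sqrtPoly k) * C_half_add_C_half

/-- Membership in the cone is an algebraic certificate of positivity on [0,1] that carries over to
operators between 0 and 1 without a spectral theorem. This lemma and the next give the bounds s_k ≤
1 and s_k ≤ s_{k+1} in that form. -/
theorem one_sub_sqrtPoly_mem (k : ℕ) : 1 - sqrtPoly k ∈ unitCone := by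
  induction k with
  | zero => simp [sqrtPoly, one_mem]
  | succ k ih =>
    rw [one_sub_sqrtPoly_succ]
    exact mul_mem C_half_mem_unitCone (add_mem one_sub_X_mem_unitCone (mul_mem ih ih))

theorem sqrtPoly_succ_sub_mem (k : ℕ) : sqrtPoly (k + 1) - sqrtPoly k ∈ unitCone := by
  induction k with
  | zero => simpa [sqrtPoly] using mul_mem C_half_mem_unitCone X_mem_unitCone
  | succ k ih =>
    have : sqrtPoly (k + 1 + 1) - sqrtPoly (k + 1) = C (1 / 2) *
        ((sqrtPoly (k + 1) - sqrtPoly k) * ((1 - sqrtPoly k) + (1 - sqrtPoly (k + 1)))) := by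
      linear_combination one_sub_sqrtPoly_succ k - one_sub_sqrtPoly_succ (k + 1)
    rw [this]
    exact mul_mem C_half_mem_unitCone (mul_mem ih
      (add_mem (one_sub_sqrtPoly_mem _) (one_sub_sqrtPoly_mem _)))

theorem sqrtPoly_sub_mem {m n : ℕ} (h : m ≤ n) : sqrtPoly n - sqrtPoly m ∈ unitCone := by
  induction n, h using Nat.le_induction with
  | base => simp [zero_mem]
  | succ n _ ih => simpa using add_mem (sqrtPoly_succ_sub_mem n) ih

theorem sqrtPoly_mem (k : ℕ) : sqrtPoly k ∈ unitCone := by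
  simpa [sqrtPoly] using sqrtPoly_sub_mem (Nat.zero_le k)

variable {H : Type*} [NormedAddCommGroup H] [InnerProductSpace ℝ H] [CompleteSpace H]

theorem isSelfAdjoint_aeval {q : H →L[ℝ] H} (hq : IsSelfAdjoint q) (p : ℝ[X]) :
    IsSelfAdjoint (aeval q p) := by
  induction p using Polynomial.induction_on' with
  | add p r hp hr => rw [map_add]; exact hp.add hr
  | monomial n a =>
    rw [aeval_monomial, ← Algebra.smul_def]
    exact (IsSelfAdjoint.all a).smul (hq.pow n)

/-- Conjugating a positive operator by the self-adjoint g(q) keeps it positive. Removing the even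
parts of the exponents writes X^i (1 - X)^j as g w g with w one of 1, X, 1 - X, X (1 - X). -/
theorem isPositive_aeval {q : H →L[ℝ] H} (hq : q.IsPositive) (hq1 : (1 - q).IsPositive) {p : ℝ[X]}
    (hp : p ∈ unitCone) : (aeval q p).IsPositive := by
  have key (w g : ℝ[X]) (hw : (aeval q w).IsPositive) : (aeval q (g * w * g)).IsPositive := by
    have h1 := hw.conj_adjoint (aeval q g)
    rw [(isSelfAdjoint_aeval hq.isSelfAdjoint g).adjoint_eq] at h1
    simpa only [map_mul, ContinuousLinearMap.mul_def, ContinuousLinearMap.comp_assoc] using h1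
  have h1 : (aeval q (1 : ℝ[X])).IsPositive := by
    simp
  have hX : (aeval q (X : ℝ[X])).IsPositive := by simpa using hq
  have hY : (aeval q (1 - X : ℝ[X])).IsPositive := by simpa using hq1
  -- The product of two commuting positive operators, written as a sum of conjugates of positive
  -- ones.
  have hXY : (aeval q (X * (1 - X) : ℝ[X])).IsPositive := by
    have : (X * (1 - X) : ℝ[X]) = (1 - X) * X * (1 - X) + X * (1 - X) * X := by ring
    rw [this, map_add]
    exact (key _ _ hX).add (key _ _ hY)
  have hp' : p ∈ Submodule.span ℝ≥0 (Submonoid.closure ({X, 1 - X} : Set ℝ[X]) : Set ℝ[X]) := by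
    rw [← Algebra.adjoin_eq_span]; exact hp
  clear hp
  induction hp' using Submodule.span_induction with
  | mem x hx =>
    obtain ⟨i, j, rfl⟩ := (Submonoid.mem_closure_pair _ _ _).1 hx
    obtain ⟨a, rfl | rfl⟩ := Nat.even_or_odd' i <;> obtain ⟨b, rfl | rfl⟩ := Nat.even_or_odd' j
    · convert key 1 (X ^ a * (1 - X) ^ b) h1 using 2; ring
    · convert key (1 - X) (X ^ a * (1 - X) ^ b) hY using 2; ring
    · convert key X (X ^ a * (1 - X) ^ b) hX using 2; ring
    · convert key (X * (1 - X)) (X ^ a * (1 - X) ^ b) hXY using 2; ring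
  | zero => simp
  | add x y _ _ hx hy => rw [map_add]; exact hx.add hy
  | smul c x _ hx =>
    rw [NNReal.smul_def, map_smul]
    exact hx.smul_of_nonneg c.2

/-- The product p (1 - p) lies in the cone, so p(q)² ≤ p(q). -/
theorem norm_sq_le_inner_aeval {q : H →L[ℝ] H} (hq : q.IsPositive) (hq1 : (1 - q).IsPositive)
    {p : ℝ[X]} (hp : p ∈ unitCone) (hp1 : 1 - p ∈ unitCone) (x : H) :
    ‖aeval q p x‖ ^ 2 ≤ ⟪aeval q p x, x⟫ := by
  have h := (isPositive_aeval hq hq1 (mul_mem hp hp1)).inner_nonneg_left x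
  have h2 := ((isSelfAdjoint_aeval hq.isSelfAdjoint p).isSymmetric : _) (aeval q p x) x
  have h3 : aeval q (p * (1 - p)) x = aeval q p x - aeval q p (aeval q p x) := by
    rw [mul_sub, mul_one, map_sub, map_mul]; rfl
  rw [h3, inner_sub_left] at h
  have h4 : ⟪aeval q p (aeval q p x), x⟫ = ‖aeval q p x‖ ^ 2 := by
    rw [← real_inner_self_eq_norm_sq]; exact h2
  linarith

/-- Vigier's argument: the squared increments of the vectors are at most the increments of the
bounded monotone sequence ⟪s_k(q) x, x⟫. -/
theorem cauchySeq_aeval_sqrtPoly {q : H →L[ℝ] H} (hq : q.IsPositive) (hq1 : (1 - q).IsPositive)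
    (x : H) : CauchySeq fun k => aeval q (sqrtPoly k) x := by
  set a : ℕ → ℝ := fun k => ⟪aeval q (sqrtPoly k) x, x⟫
  have hle {m n : ℕ} (h : m ≤ n) :
      ‖aeval q (sqrtPoly n) x - aeval q (sqrtPoly m) x‖ ^ 2 ≤ a n - a m := by
    have h1 : 1 - (sqrtPoly n - sqrtPoly m) ∈ unitCone := by
      convert add_mem (one_sub_sqrtPoly_mem n) (sqrtPoly_mem m) using 1; ring
    have := norm_sq_le_inner_aeval hq hq1 (sqrtPoly_sub_mem h) h1 x
    simpa [a, inner_sub_left] using this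
  have hmono : Monotone a := fun m n h => sub_nonneg.1 ((sq_nonneg _).trans (hle h))
  have hbdd : BddAbove (range a) := by
    refine ⟨⟪x, x⟫, ?_⟩
    rintro _ ⟨k, rfl⟩
    have := (isPositive_aeval hq hq1 (one_sub_sqrtPoly_mem k)).inner_nonneg_left x
    simpa [inner_sub_left] using this
  have ha : CauchySeq a := (tendsto_atTop_ciSup hmono hbdd).cauchySeq
  rw [Metric.cauchySeq_iff'] at ha ⊢
  intro ε hε
  obtain ⟨N, hN⟩ := ha (ε ^ 2) (by positivity)
  refine ⟨N, fun n hn => ?_⟩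
  rw [dist_eq_norm]
  have h1 := hN n hn
  rw [Real.dist_eq] at h1
  exact lt_of_pow_lt_pow_left₀ 2 hε.le ((hle hn).trans_lt ((le_abs_self _).trans_lt h1))

theorem exists_sqrt_of_le_one {q : H →L[ℝ] H} (hq : q.IsPositive) (hq1 : (1 - q).IsPositive) :
    ∃ S : H →L[ℝ] H, S.IsPositive ∧ S ∘L S = q ∧
      ∀ x, Tendsto (fun k => aeval q (sqrtPoly k) x) atTop (𝓝 (S x)) := by
  choose f hf using fun x => cauchySeq_tendsto_of_complete (cauchySeq_aeval_sqrtPoly hq hq1 x)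
  set S : H →L[ℝ] H := continuousLinearMapOfTendsto (fun k => aeval q (sqrtPoly k))
    (tendsto_pi_nhds.2 hf) with hS
  have hSf (x : H) : Tendsto (fun k => aeval q (sqrtPoly k) x) atTop (𝓝 (S x)) := hf x
  have hpos (k : ℕ) := isPositive_aeval hq hq1 (sqrtPoly_mem k)
  refine ⟨S, ?_, ?_, hSf⟩
  · refine (ContinuousLinearMap.isPositive_iff _).2 ⟨fun x y => ?_, fun x => ?_⟩
    · exact tendsto_nhds_unique (((hSf x).inner tendsto_const_nhds).congr fun k =>
        (hpos k).inner_left_eq_inner_right x y) (tendsto_const_nhds.inner (hSf y))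
    · exact ge_of_tendsto' ((hSf x).inner tendsto_const_nhds)
        fun k => (hpos k).inner_nonneg_left x
  · refine ContinuousLinearMap.ext fun x => ext_inner_right ℝ fun y => ?_
    have h1 : Tendsto (fun k => ⟪aeval q (sqrtPoly k) x, aeval q (sqrtPoly k) y⟫) atTop
        (𝓝 ⟪S x, S y⟫) := (hSf x).inner (hSf y)
    have h2 : ⟪S (S x), y⟫ = ⟪S x, S y⟫ :=
      tendsto_nhds_unique (((hSf (S x)).inner tendsto_const_nhds).congr fun k =>
        (hpos k).inner_left_eq_inner_right _ y) (tendsto_const_nhds.inner (hSf y))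
    rw [ContinuousLinearMap.comp_apply, h2]
    -- The recursion reads s_k² = X - 2 (s_{k+1} - s_k), and the increments tend to zero, so s_k(q)²
    -- tends weakly to q.
    have h3 : Tendsto (fun k => ⟪q x, y⟫ - 2 * (⟪aeval q (sqrtPoly (k + 1)) x, y⟫ -
        ⟪aeval q (sqrtPoly k) x, y⟫)) atTop (𝓝 (⟪q x, y⟫ - 2 * (⟪S x, y⟫ - ⟪S x, y⟫))) := by
      refine tendsto_const_nhds.sub (Tendsto.const_mul 2 (Tendsto.sub ?_ ?_))
      · exact ((tendsto_add_atTop_iff_nat 1).2 (hSf x)).inner tendsto_const_nhds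
      · exact (hSf x).inner tendsto_const_nhds
    rw [sub_self, mul_zero, sub_zero] at h3
    refine tendsto_nhds_unique (h1.congr fun k => ?_) h3
    have h4 : aeval q (sqrtPoly (k + 1)) x = aeval q (sqrtPoly k) x +
        (1 / 2 : ℝ) • (q x - aeval q (sqrtPoly k) (aeval q (sqrtPoly k) x)) := by
      rw [sqrtPoly, map_add, map_mul, map_sub, map_pow, aeval_C, aeval_X, ← Algebra.smul_def, sq]
      rfl
    rw [h4, ← (hpos k).inner_left_eq_inner_right, inner_add_left, inner_smul_left, inner_sub_left]
    simp

omit [CompleteSpace H] in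
-- The quadratic t ↦ ⟪R (y + t R y), y + t R y⟫ is nonnegative with zero constant term, so its
-- linear coefficient 2 ‖R y‖² must vanish.
theorem apply_eq_zero_of_inner_eq_zero {R : H →L[ℝ] H} (hR : R.IsPositive) {y : H}
    (h : ⟪R y, y⟫ = 0) : R y = 0 := by
  have h1 : discrim ⟪R (R y), R y⟫ (2 * ⟪R y, R y⟫) 0 ≤ 0 := by
    refine discrim_le_zero fun t => ?_
    have h2 := hR.inner_nonneg_left (y + t • R y)
    have h3 : ⟪R (R y), y⟫ = ⟪R y, R y⟫ := hR.inner_left_eq_inner_right _ _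
    simp only [map_add, map_smul, inner_add_left, inner_add_right, inner_smul_left,
      inner_smul_right, h, h3] at h2
    simp at h2 ⊢
    linarith
  rw [discrim] at h1
  have h2 : ⟪R y, R y⟫ = 0 := by nlinarith [sq_nonneg ⟪R y, R y⟫]
  exact inner_self_eq_zero.1 h2

omit [CompleteSpace H] in
-- For y = R x - S x, commutation and equality of squares give (R + S) y = 0. Positivity then forces
-- R y = S y = 0, and ‖y‖² = ⟪(R - S) y, x⟫ = 0.
theorem sqrt_unique {R S : H →L[ℝ] H} (hR : R.IsPositive) (hS : S.IsPositive)
    (hc : ∀ x, R (S x) = S (R x)) (h : ∀ x, R (R x) = S (S x)) : R = S := by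
  refine ContinuousLinearMap.ext fun x => ?_
  rw [← sub_eq_zero]
  set y := R x - S x with hy
  have h1 : R y + S y = 0 := by
    rw [hy, map_sub, map_sub, hc, h]; abel
  have h2 : ⟪R y, y⟫ + ⟪S y, y⟫ = 0 := by rw [← inner_add_left, h1, inner_zero_left]
  have h3 := hR.inner_nonneg_left y
  have h4 := hS.inner_nonneg_left y
  have h5 : R y = 0 := apply_eq_zero_of_inner_eq_zero hR (by linarith)
  have h6 : S y = 0 := apply_eq_zero_of_inner_eq_zero hS (by linarith)
  refine (inner_self_eq_zero (𝕜 := ℝ)).1 ?_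
  calc ⟪y, y⟫ = ⟪y, R x⟫ - ⟪y, S x⟫ := by rw [← inner_sub_right]
    _ = ⟪R y, x⟫ - ⟪S y, x⟫ := by
      rw [hR.inner_left_eq_inner_right, hS.inner_left_eq_inner_right]
    _ = 0 := by simp [h5, h6]

/-- The operator `Q / (1 + ‖Q‖)`. -/
def normalize (Q : H →L[ℝ] H) : H →L[ℝ] H := (1 + ‖Q‖)⁻¹ • Q

omit [CompleteSpace H] in
-- Dividing by 1 + ‖Q‖ instead of ‖Q‖ covers Q = 0 as well.
theorem isPositive_one_sub_normalize {Q : H →L[ℝ] H} (hQ : Q.IsPositive) :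
    (1 - normalize Q).IsPositive := by
  have hn : 0 < 1 + ‖Q‖ := by positivity
  refine (ContinuousLinearMap.isPositive_iff _).2 ⟨fun x y => ?_, fun x => ?_⟩
  · have := hQ.inner_left_eq_inner_right x y
    simp [normalize, inner_sub_left, inner_sub_right, inner_smul_left, inner_smul_right, this]
  · have h1 : ⟪Q x, x⟫ ≤ ‖Q‖ * ⟪x, x⟫ := by
      rw [real_inner_self_eq_norm_sq, sq, ← mul_assoc]
      exact (real_inner_le_norm _ _).trans
        (mul_le_mul_of_nonneg_right (Q.le_opNorm x) (norm_nonneg x))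
    have h2 : (1 + ‖Q‖)⁻¹ * ⟪Q x, x⟫ ≤ ⟪x, x⟫ := by
      rw [inv_mul_le_iff₀ hn]
      linarith [real_inner_self_nonneg (x := x)]
    simpa [normalize, inner_sub_left, inner_smul_left] using h2

theorem exists_sqrt {Q : H →L[ℝ] H} (hQ : Q.IsPositive) :
    ∃ S : H →L[ℝ] H, S.IsPositive ∧ S ∘L S = Q ∧
      ∀ x, Tendsto (fun k => √(1 + ‖Q‖) • aeval (normalize Q) (sqrtPoly k) x) atTop
        (𝓝 (S x)) := by
  have hn : 0 < 1 + ‖Q‖ := by positivity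
  obtain ⟨S, hS, hSS, hlim⟩ := exists_sqrt_of_le_one
    (hQ.smul_of_nonneg (c := (1 + ‖Q‖)⁻¹) (by positivity)) (isPositive_one_sub_normalize hQ)
  refine ⟨√(1 + ‖Q‖) • S, hS.smul_of_nonneg (Real.sqrt_nonneg _), ?_,
    fun x => (hlim x).const_smul _⟩
  rw [ContinuousLinearMap.smul_comp, ContinuousLinearMap.comp_smul, hSS, smul_smul, smul_smul,
    Real.mul_self_sqrt hn.le, mul_inv_cancel₀ hn.ne', one_smul]

theorem posSqrt_spec {Q : H →L[ℝ] H} (hQ : Q.IsPositive) :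
    (posSqrt Q).IsPositive ∧ posSqrt Q ∘L posSqrt Q = Q := by
  have h : ∃ R : H →L[ℝ] H, R.IsPositive ∧ R ∘L R = Q :=
    let ⟨S, h1, h2, _⟩ := exists_sqrt hQ; ⟨S, h1, h2⟩
  rw [posSqrt, dif_pos h]
  exact h.choose_spec

omit [CompleteSpace H] in
theorem posSqrt_of_not_isPositive {Q : H →L[ℝ] H} (hQ : ¬ Q.IsPositive) : posSqrt Q = 0 := by
  refine dif_neg ?_
  rintro ⟨R, hR, rfl⟩
  refine hQ ((ContinuousLinearMap.isPositive_iff _).2 ⟨fun x y => ?_, fun x => ?_⟩)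
  · exact (hR.inner_left_eq_inner_right _ _).trans (hR.inner_left_eq_inner_right _ _)
  · exact (real_inner_self_nonneg (x := R x)).trans_eq (hR.inner_left_eq_inner_right _ _).symm

theorem posSqrt_isPositive (Q : H →L[ℝ] H) : (posSqrt Q).IsPositive := by
  by_cases hQ : Q.IsPositive
  · exact (posSqrt_spec hQ).1
  · rw [posSqrt_of_not_isPositive hQ]; exact ContinuousLinearMap.isPositive_zero

/-- The chosen root commutes with Q, being a root of it, hence with all polynomials in `normalize Q`
and with their limit. Uniqueness among commuting positive roots identifies the two. -/
theorem tendsto_posSqrt {Q : H →L[ℝ] H} (hQ : Q.IsPositive) (x : H) :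
    Tendsto (fun k => √(1 + ‖Q‖) • aeval (normalize Q) (sqrtPoly k) x) atTop
      (𝓝 (posSqrt Q x)) := by
  obtain ⟨S, hS, hSS, hlim⟩ := exists_sqrt hQ
  obtain ⟨hR, hRR⟩ := posSqrt_spec hQ
  suffices posSqrt Q = S from this ▸ hlim x
  refine sqrt_unique hR hS (fun y => ?_) fun y => ?_
  · have h1 : Commute (posSqrt Q) (normalize Q) := by
      have : Commute (posSqrt Q) (posSqrt Q ∘L posSqrt Q) :=
        (Commute.refl (posSqrt Q)).mul_right (Commute.refl _)
      rw [hRR] at this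
      exact this.smul_right _
    have h2 (p : ℝ[X]) : Commute (posSqrt Q) (aeval (normalize Q) p) := by
      induction p using Polynomial.induction_on' with
      | add p r hp hr => rw [map_add]; exact hp.add_right hr
      | monomial n a =>
        rw [aeval_monomial, ← Algebra.smul_def]
        exact (h1.pow_right n).smul_right a
    refine tendsto_nhds_unique (((posSqrt Q).continuous.tendsto _).comp (hlim y))
      ((hlim (posSqrt Q y)).congr fun k => ?_)
    have h3 := congrArg (fun W : H →L[ℝ] H => W y) (h2 (sqrtPoly k)).eq
    simp only [mul_apply_eq_comp] at h3
    simp [h3]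
  · have h1 := congrArg (fun W : H →L[ℝ] H => W y) (hRR.trans hSS.symm)
    exact h1

/-- The maximum with 0 accounts for operators that are not positive, whose root is 0 by convention.
-/
theorem norm_posSqrt_sq_le (Q : H →L[ℝ] H) (x : H) :
    ‖posSqrt Q x‖ ^ 2 ≤ max ⟪Q x, x⟫ 0 := by
  by_cases hQ : Q.IsPositive
  · obtain ⟨hR, hRR⟩ := posSqrt_spec hQ
    refine le_max_of_le_left (Eq.le ?_)
    rw [← real_inner_self_eq_norm_sq, ← hR.inner_left_eq_inner_right]
    exact congrArg (fun W : H →L[ℝ] H => ⟪W x, x⟫) hRR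
  · simp [posSqrt_of_not_isPositive hQ]

end PolynomialCone

/-! ### Measurability of the positive square root -/

section SqrtMeasurable

variable {Z : Type*} {mZ : MeasurableSpace Z} {H : Type*} [NormedAddCommGroup H]
  [InnerProductSpace ℝ H] [CompleteSpace H] [TopologicalSpace.SeparableSpace H]
  [MeasurableSpace H] [BorelSpace H]

/-- Expanding f along the orthonormal system reduces this to constant arguments; it makes powers of
a measurable family measurable. -/
theorem measurable_apply_of_measurable {Q : Z → H →L[ℝ] H} (hQ : ∀ x, Measurable fun z => Q z x)
    {f : Z → H} (hf : Measurable f) : Measurable fun z => Q z (f z) := by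
  have : SecondCountableTopology H := UniformSpace.secondCountable_of_separable H
  refine measurable_of_tendsto_metrizable' (atTop : Filter (Finset (onbIndex H)))
    (f := fun s z => ∑ i ∈ s, ⟪onb H i, f z⟫ • Q z (onb H i)) (fun s => ?_) ?_
  · exact Finset.measurable_sum _ fun i _ => (measurable_const.inner hf).smul (hQ _)
  · rw [tendsto_pi_nhds]
    intro z
    have := ((onb H).hasSum_repr (f z)).mapL (Q z)
    simp_rw [(onb H).repr_apply_apply, map_smul] at this
    exact this

omit [CompleteSpace H] in
theorem measurable_norm_of_measurable_apply {Q : Z → H →L[ℝ] H}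
    (hQ : ∀ x, Measurable fun z => Q z x) : Measurable fun z => ‖Q z‖ := by
  refine measurable_of_Iic fun c => ?_
  by_cases hc : 0 ≤ c
  · have : (fun z => ‖Q z‖) ⁻¹' Iic c = ⋂ n : ℕ, {z | ‖Q z (TopologicalSpace.denseSeq H n)‖ ≤
        c * ‖TopologicalSpace.denseSeq H n‖} := by
      ext z
      simp only [mem_preimage, mem_Iic, mem_iInter, mem_ofPred_eq]
      refine ⟨fun h n => (Q z).le_of_opNorm_le h _, fun h => ?_⟩
      refine (Q z).opNorm_le_bound hc fun x => ?_
      exact (TopologicalSpace.denseRange_denseSeq H).induction_on x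
        (isClosed_le (by fun_prop) (by fun_prop)) h
    rw [this]
    exact MeasurableSet.iInter fun n => measurableSet_le (hQ _).norm measurable_const
  · rw [show (fun z => ‖Q z‖) ⁻¹' Iic c = ∅ from ?_]
    · exact MeasurableSet.empty
    · ext z
      simp only [mem_preimage, mem_Iic, mem_empty_iff_false, iff_false]
      exact fun h => hc ((norm_nonneg _).trans h)

theorem measurableSet_isPositive {Q : Z → H →L[ℝ] H} (hQ : ∀ x, Measurable fun z => Q z x) :
    MeasurableSet {z | (Q z).IsPositive} := by
  set d := TopologicalSpace.denseSeq H
  have hd : DenseRange d := TopologicalSpace.denseRange_denseSeq H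
  have : {z | (Q z).IsPositive} = (⋂ m, ⋂ n, {z | ⟪Q z (d m), d n⟫ = ⟪d m, Q z (d n)⟫}) ∩
      ⋂ n, {z | 0 ≤ ⟪Q z (d n), d n⟫} := by
    ext z
    simp only [mem_ofPred_eq, mem_inter_iff, mem_iInter]
    refine ⟨fun h => ⟨fun m n => h.inner_left_eq_inner_right _ _,
      fun n => h.inner_nonneg_left _⟩, fun ⟨h1, h2⟩ =>
      (ContinuousLinearMap.isPositive_iff _).2 ⟨fun x y => ?_, fun x => ?_⟩⟩
    · exact hd.induction_on₂ (p := fun x y => ⟪Q z x, y⟫ = ⟪x, Q z y⟫)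
        (isClosed_eq (by fun_prop) (by fun_prop)) h1 x y
    · exact hd.induction_on (p := fun x => 0 ≤ ⟪Q z x, x⟫) x
        (isClosed_le (by fun_prop) (by fun_prop)) h2
  rw [this]
  refine MeasurableSet.inter ?_ ?_
  · exact MeasurableSet.iInter fun m => MeasurableSet.iInter fun n => measurableSet_eq_fun
      ((hQ _).inner measurable_const) (measurable_const.inner (hQ _))
  · exact MeasurableSet.iInter fun n => measurableSet_le measurable_const
      ((hQ _).inner measurable_const)

open Polynomial in
/-- The positive square root of a weakly measurable family of operators is measurable. -/
theorem measurable_posSqrt_apply {Q : Z → H →L[ℝ] H}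
    (hQ : ∀ x y, Measurable fun z => ⟪Q z x, y⟫) (x : H) :
    Measurable fun z => posSqrt (Q z) x := by
  have : SecondCountableTopology H := UniformSpace.secondCountable_of_separable H
  have hQ' (x : H) : Measurable fun z => Q z x :=
    measurable_of_inner fun y => by simpa only [real_inner_comm] using hQ x y
  have hn := measurable_norm_of_measurable_apply hQ'
  have hq (x : H) : Measurable fun z => normalize (Q z) x :=
    ((measurable_const.add hn).inv).smul (hQ' x)
  have hpow (n : ℕ) (x : H) : Measurable fun z => (normalize (Q z) ^ n) x := by
    induction n with
    | zero => simp
    | succ n ih =>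
      simp_rw [pow_succ', mul_apply_eq_comp]
      exact measurable_apply_of_measurable hq ih
  have hp (p : ℝ[X]) : Measurable fun z => aeval (normalize (Q z)) p x := by
    induction p using Polynomial.induction_on' with
    | add p r hp hr => simp_rw [map_add]; exact hp.add hr
    | monomial n a =>
      simp_rw [aeval_monomial, ← Algebra.smul_def]
      exact (hpow n x).const_smul a
  have hE := measurableSet_isPositive hQ'
  -- The polynomials approximate the root only where Q is positive; elsewhere the root is 0.
  have : (fun z => posSqrt (Q z) x) =
      {z | (Q z).IsPositive}.indicator fun z => posSqrt (Q z) x := by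
    ext z
    by_cases hz : (Q z).IsPositive
    · rw [indicator_of_mem (by exact hz)]
    · rw [indicator_of_notMem (by exact hz), posSqrt_of_not_isPositive hz]; rfl
  rw [this]
  refine measurable_of_tendsto_metrizable (f := fun k => {z | (Q z).IsPositive}.indicator fun z =>
    √(1 + ‖Q z‖) • aeval (normalize (Q z)) (sqrtPoly k) x) (fun k => ?_) ?_
  · exact (((measurable_const.add hn).sqrt).smul (hp _)).indicator hE
  · rw [tendsto_pi_nhds]
    intro z
    by_cases hz : (Q z).IsPositive
    · simp_rw [indicator_of_mem (show z ∈ {z | (Q z).IsPositive} from hz)]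
      exact tendsto_posSqrt hz x
    · simp_rw [indicator_of_notMem (show z ∉ {z | (Q z).IsPositive} from hz)]
      exact tendsto_const_nhds

end SqrtMeasurable

/-! ### Square integrable fields of Hilbert-Schmidt operators -/

section SumMeasure

variable {Z ι : Type*} {mZ : MeasurableSpace Z} [Countable ι] [MeasurableSpace ι]

/-- The product of `μ` and the counting measure of `ι`. -/
def copies (μ : Measure Z) (ι : Type*) [MeasurableSpace ι] : Measure (Z × ι) :=
  Measure.sum fun k : ι => μ.map fun z => (z, k)

variable {μ : Measure Z}

theorem lintegral_copies {f : Z × ι → ℝ≥0∞} (hf : Measurable f) :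
    ∫⁻ p, f p ∂(copies μ ι) = ∫⁻ z, ∑' k, f (z, k) ∂μ := by
  have h (k : ι) : Measurable fun z => f (z, k) := hf.comp (measurable_id.prodMk measurable_const)
  rw [copies, lintegral_sum_measure, lintegral_tsum fun k => (h k).aemeasurable]
  exact tsum_congr fun k => lintegral_map hf (measurable_id.prodMk measurable_const)

omit [MeasurableSpace ι] in
theorem integrable_tsum {F : ι → Z → ℝ} (hF : ∀ k, AEStronglyMeasurable (F k) μ)
    (hsum : ∑' k, ∫⁻ z, ‖F k z‖ₑ ∂μ ≠ ∞) : Integrable (fun z => ∑' k, F k z) μ := by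
  rw [← lintegral_tsum fun k => (hF k).enorm] at hsum
  have h1 : ∀ᵐ z ∂μ, Summable fun k => F k z := by
    filter_upwards [ae_lt_top' (AEMeasurable.tsum fun k => (hF k).enorm) hsum] with z hz
    exact Summable.of_enorm hz.ne
  refine ⟨?_, ?_⟩
  · exact aestronglyMeasurable_of_tendsto_ae (atTop : Filter (Finset ι))
      (f := fun s z => ∑ k ∈ s, F k z)
      (fun s => Finset.aestronglyMeasurable_fun_sum s fun k _ => hF k) (h1.mono fun z hz => hz.hasSum)
  · exact (lintegral_mono fun z => enorm_tsum_le_tsum_enorm).trans_lt hsum.lt_top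

theorem integral_copies {f : Z × ι → ℝ} (hf : Integrable f (copies μ ι)) :
    Integrable (fun z => ∑' k, f (z, k)) μ ∧
      ∫ p, f p ∂(copies μ ι) = ∫ z, ∑' k, f (z, k) ∂μ := by
  have hm (k : ι) : AEMeasurable (fun z => (z, k)) μ :=
    (measurable_id.prodMk measurable_const).aemeasurable
  have h1 := hf.summable_integral
  have h2 (k : ι) : Integrable f (μ.map fun z => (z, k)) :=
    hf.mono_measure (Measure.le_sum (fun k : ι => μ.map fun z => (z, k)) k)
  have h3 (k : ι) : Integrable (fun z => f (z, k)) μ := (h2 k).comp_aemeasurable (hm k)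
  have h4 (k : ι) : ∫ x, ‖f x‖ ∂(μ.map fun z => (z, k)) = ∫ z, ‖f (z, k)‖ ∂μ :=
    integral_map (hm k) (h2 k).1.norm
  simp_rw [h4] at h1
  refine ⟨?_, ?_⟩
  · refine integrable_tsum (fun k => (h3 k).1) ?_
    simp_rw [← ofReal_integral_norm_eq_lintegral_enorm (h3 _)]
    exact h1.tsum_ofReal_ne_top
  · rw [← (hasSum_integral_of_summable_integral_norm h3 h1).tsum_eq, copies,
      integral_sum_measure hf]
    exact tsum_congr fun k => integral_map (hm k) (h2 k).1

end SumMeasure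

/-! ### Matrix entries and orthogonality to rank one operators -/

section RankOne

variable {H G : Type*} [NormedAddCommGroup H] [InnerProductSpace ℝ H] [CompleteSpace H]
  [NormedAddCommGroup G] [InnerProductSpace ℝ G] [CompleteSpace G]

variable (H G) in
/-- The index set of the matrix entries of an operator from `H` to `G`. -/
abbrev EntryIndex : Type _ := onbIndex H × onbIndex G

/-- The matrix entries of an operator. -/
def entry (S : H →L[ℝ] G) (k : EntryIndex H G) : ℝ := ⟪onb G k.2, S (onb H k.1)⟫

theorem summable_entry_sq {S : H →L[ℝ] G} (hS : IsHilbertSchmidt S) :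
    Summable fun k => entry S k ^ 2 := by
  unfold IsHilbertSchmidt at hS
  rw [hsNormSq_eq_tsum_entries] at hS
  refine (ENNReal.summable_toReal hS.ne).congr fun k => ?_
  rw [enorm_sq_eq_ofReal, ENNReal.toReal_ofReal (sq_nonneg _), Real.norm_eq_abs, sq_abs, entry]

theorem summable_mul_of_sq {ι : Type*} {a c : ι → ℝ} (ha : Summable fun k => a k ^ 2)
    (hc : Summable fun k => c k ^ 2) : Summable fun k => a k * c k := by
  refine Summable.of_norm_bounded (ha.add hc) fun k => ?_
  rw [Real.norm_eq_abs, abs_le]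
  constructor <;> nlinarith [sq_nonneg (a k + c k), sq_nonneg (a k - c k)]

/-- The operator `x ↦ ⟪h, x⟫ b` with `b` in the chosen orthonormal system. -/
def rankOneOp (h : H) (b : onbIndex G) : H →L[ℝ] G := (innerSL ℝ h).smulRight (onb G b)

theorem entry_rankOneOp_comp {R : H →L[ℝ] H} (hR : ∀ x y, ⟪R x, y⟫ = ⟪x, R y⟫) (h : H)
    (b : onbIndex G) (k : EntryIndex H G) :
    entry (rankOneOp h b ∘L R) k = ⟪R h, onb H k.1⟫ * ⟪onb G k.2, onb G b⟫ := by
  simp [entry, rankOneOp, inner_smul_right, hR]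

theorem hsNormSq_rankOneOp_comp {R : H →L[ℝ] H} (hR : ∀ x y, ⟪R x, y⟫ = ⟪x, R y⟫) (h : H)
    (b : onbIndex G) : hsNormSq (rankOneOp h b ∘L R) = ‖R h‖ₑ ^ 2 := by
  rw [enorm_sq_eq_tsum (onb H)]
  refine tsum_congr fun i => ?_
  have hb : ‖onb G b‖ₑ = 1 := by rw [← ofReal_norm, (onb G).orthonormal.1 b, ENNReal.ofReal_one]
  simp [rankOneOp, enorm_smul, hb, ← hR, real_inner_comm]

/-- If a square summable matrix is orthogonal to all rank one operators composed with `R`, then it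
is orthogonal to the Hilbert-Schmidt operators that vanish on the kernel of `R`. -/
theorem tsum_mul_entry_eq_zero {R : H →L[ℝ] H} (hR : ∀ x y, ⟪R x, y⟫ = ⟪x, R y⟫)
    {D : Set H} (hD : Dense D) {a : EntryIndex H G → ℝ} (ha : Summable fun k => a k ^ 2)
    (h0 : ∀ h ∈ D, ∀ b, ∑' k, entry (rankOneOp h b ∘L R) k * a k = 0)
    {S : H →L[ℝ] G} (hS : IsHilbertSchmidt S) (hker : ∀ x, R x = 0 → S x = 0) :
    ∑' k, entry S k * a k = 0 := by
  have hab (b : onbIndex G) : Summable fun i => a (i, b) ^ 2 :=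
    ha.comp_injective (Prod.mk_left_injective b)
  have hmem (b : onbIndex G) : Memℓp (fun i => a (i, b)) 2 := by
    refine memℓp_gen ((hab b).congr fun i => ?_)
    simp
  -- The entries with second index b are square summable, so they are the coordinates of a vector of
  -- H.
  set x : onbIndex G → H := fun b => (onb H).repr.symm ⟨_, hmem b⟩ with hx
  have hxi (b : onbIndex G) (i : onbIndex H) : ⟪onb H i, x b⟫ = a (i, b) := by
    rw [← (onb H).repr_apply_apply, hx, LinearIsometryEquiv.apply_symm_apply]
  have hRx (b : onbIndex G) : R (x b) = 0 := by
    refine hD.eq_zero_of_inner_left (𝕜 := ℝ) fun h hh => ?_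
    have h1 := h0 h hh b
    -- Only entries with second index b survive, and their sum is ⟪R h, x b⟫ = ⟪h, R (x b)⟫.
    rw [← (Prod.mk_left_injective (α := onbIndex H) b).tsum_eq] at h1
    · have hb : ⟪onb G b, onb G b⟫ = (1 : ℝ) := by
        rw [real_inner_self_eq_norm_sq, (onb G).orthonormal.1 b]; norm_num
      simp_rw [entry_rankOneOp_comp hR, hb, mul_one, ← hxi] at h1
      rw [(onb H).tsum_inner_mul_inner, hR, real_inner_comm] at h1
      exact h1
    · rintro ⟨i, c⟩ hk
      rw [Function.mem_support, entry_rankOneOp_comp hR] at hk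
      by_cases hcb : c = b
      · exact ⟨i, by rw [hcb]⟩
      · exact absurd (by rw [(onb G).orthonormal.2 hcb, mul_zero, zero_mul]) hk
  have hsum := summable_mul_of_sq (summable_entry_sq hS) ha
  rw [← (Equiv.prodComm (onbIndex G) (onbIndex H)).tsum_eq]
  have hsum' : Summable fun c => entry S (Equiv.prodComm (onbIndex G) (onbIndex H) c) *
      a (Equiv.prodComm (onbIndex G) (onbIndex H) c) := (Equiv.prodComm (onbIndex G) (onbIndex H)).summable_iff.2 hsum
  rw [hsum'.tsum_prod' fun b => hsum'.comp_injective (Prod.mk_right_injective b)]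
  refine (tsum_congr fun b => ?_).trans tsum_zero
  -- The sum over the entries with second index b is ⟪S* b, x b⟫ = ⟪b, S (x b)⟫, and S (x b) = 0
  -- since x b lies in the kernel of R.
  have h2 := (onb H).tsum_inner_mul_inner (ContinuousLinearMap.adjoint S (onb G b)) (x b)
  rw [ContinuousLinearMap.adjoint_inner_left, hker _ (hRx b), inner_zero_right] at h2
  rw [← h2]
  refine tsum_congr fun i => ?_
  rw [hxi, ContinuousLinearMap.adjoint_inner_left]
  rfl

end RankOne

/-! ### Operator fields as scalar square integrable functions; the density criterion -/

section Density

variable {Z : Type*} {mZ : MeasurableSpace Z} {μ : Measure Z}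
  {H G : Type*} [NormedAddCommGroup H] [InnerProductSpace ℝ H] [CompleteSpace H]
  [TopologicalSpace.SeparableSpace H]
  [NormedAddCommGroup G] [InnerProductSpace ℝ G] [CompleteSpace G]
  [TopologicalSpace.SeparableSpace G]

/-- The matrix entries of a field of operators. -/
def entryFn (Λ : Z → H →L[ℝ] G) (p : Z × EntryIndex H G) : ℝ := entry (Λ p.1) p.2

variable [MeasurableSpace (EntryIndex H G)] [DiscreteMeasurableSpace (EntryIndex H G)]

theorem measurable_entryFn {Λ : Z → H →L[ℝ] G} (hΛ : ∀ x y, Measurable fun z => ⟪Λ z x, y⟫) :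
    Measurable (entryFn Λ) := by
  refine measurable_from_prod_countable_left fun k => ?_
  simpa only [entryFn, entry, real_inner_comm] using hΛ (onb H k.1) (onb G k.2)

/-- Passing to entries is isometric, so orthogonality arguments can be run in a scalar L² space
instead of one with values in Hilbert–Schmidt operators. -/
theorem eLpNorm_entryFn {Λ : Z → H →L[ℝ] G} (hΛ : ∀ x y, Measurable fun z => ⟪Λ z x, y⟫) :
    eLpNorm (entryFn Λ) 2 (copies μ (EntryIndex H G)) =
      (∫⁻ z, hsNormSq (Λ z) ∂μ) ^ (1 / 2 : ℝ) := by
  rw [eLpNorm_eq_lintegral_rpow_enorm_toReal (by norm_num) (by norm_num)]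
  simp only [ENNReal.toReal_ofNat, ENNReal.rpow_two]
  rw [lintegral_copies ((measurable_entryFn hΛ).enorm.pow_const 2)]
  simp_rw [hsNormSq_eq_tsum_entries]
  rfl

theorem memLp_entryFn {Λ : Z → H →L[ℝ] G} (hΛ : ∀ x y, Measurable fun z => ⟪Λ z x, y⟫)
    (hfin : ∫⁻ z, hsNormSq (Λ z) ∂μ < ∞) :
    MemLp (entryFn Λ) 2 (copies μ (EntryIndex H G)) := by
  refine ⟨(measurable_entryFn hΛ).aestronglyMeasurable, ?_⟩
  rw [eLpNorm_entryFn hΛ]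
  exact ENNReal.rpow_lt_top_of_nonneg (by norm_num) hfin.ne

end Density

section Density

variable {Z : Type*} {mZ : MeasurableSpace Z} {μ : Measure Z}
  {H G : Type*} [NormedAddCommGroup H] [InnerProductSpace ℝ H] [CompleteSpace H]
  [TopologicalSpace.SeparableSpace H]
  [NormedAddCommGroup G] [InnerProductSpace ℝ G] [CompleteSpace G]
  [TopologicalSpace.SeparableSpace G]

/-- Density, among the square integrable fields of Hilbert-Schmidt operators that vanish on the
kernel of `R`, of the combinations of the fields `1_B (S ∘ R)` with `B` in a class of sets
that is rich enough to test that a function vanishes. -/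
theorem exists_simple_approx {R : Z → H →L[ℝ] H} (hRm : ∀ x y, Measurable fun z => ⟪R z x, y⟫)
    (hR : ∀ z x y, ⟪R z x, y⟫ = ⟪x, R z y⟫) {𝓑 : Set (Set Z)} (h𝓑 : ∀ B ∈ 𝓑, MeasurableSet B)
    (hfin : ∀ B ∈ 𝓑, ∀ h, ∫⁻ z in B, ‖R z h‖ₑ ^ 2 ∂μ < ∞)
    (hsep : ∀ (h : H) (φ : Z → ℝ),
      (∀ B ∈ 𝓑, IntegrableOn φ B μ ∧ ∫ z in B, φ z ∂μ = 0) → ∀ᵐ z ∂μ, R z h ≠ 0 → φ z = 0)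
    {L : Z → H →L[ℝ] G} (hLm : ∀ x y, Measurable fun z => ⟪L z x, y⟫)
    (hLker : ∀ z x, R z x = 0 → L z x = 0) (hL : ∀ z, IsHilbertSchmidt (L z))
    (hLfin : ∫⁻ z, hsNormSq (L z) ∂μ < ∞) {ε : ℝ≥0∞} (hε : 0 < ε) :
    ∃ (n : ℕ) (B : Fin n → Set Z) (S : Fin n → H →L[ℝ] G), (∀ k, B k ∈ 𝓑) ∧
      (∀ k, IsHilbertSchmidt (S k)) ∧
      (∫⁻ z, hsNormSq (L z - ∑ k, (B k).indicator (1 : Z → ℝ) z • (S k ∘L R z)) ∂μ) ^ (1 / 2 : ℝ)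
        < ε := by
  let _ : MeasurableSpace (EntryIndex H G) := ⊤
  have _ : DiscreteMeasurableSpace (EntryIndex H G) := ⟨fun _ => trivial⟩
  set m := copies μ (EntryIndex H G) with hm
  let Λ : 𝓑 × H × onbIndex G → Z → H →L[ℝ] G := fun q z =>
    (q.1 : Set Z).indicator (1 : Z → ℝ) z • (rankOneOp q.2.1 q.2.2 ∘L R z)
  have hΛm (q : 𝓑 × H × onbIndex G) (x : H) (y : G) : Measurable fun z => ⟪Λ q z x, y⟫ := by
    simp only [Λ, _root_.smul_apply, inner_smul_left, rankOneOp, ContinuousLinearMap.comp_apply,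
      ContinuousLinearMap.smulRight_apply, innerSL_apply_apply]
    refine (measurable_one.indicator (h𝓑 _ q.1.2)).mul (Measurable.mul ?_ measurable_const)
    simpa [real_inner_comm] using hRm x q.2.1
  have hΛn (q : 𝓑 × H × onbIndex G) (z : Z) : hsNormSq (Λ q z) =
      (q.1 : Set Z).indicator (fun z => ‖R z q.2.1‖ₑ ^ 2) z := by
    by_cases hz : z ∈ (q.1 : Set Z)
    · simp [Λ, hz, hsNormSq_rankOneOp_comp (hR z)]
    · simp [Λ, hz, hsNormSq_zero]
  have hΛfin (q : 𝓑 × H × onbIndex G) : ∫⁻ z, hsNormSq (Λ q z) ∂μ < ∞ := by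
    simp_rw [hΛn, lintegral_indicator (h𝓑 _ q.1.2)]
    exact hfin _ q.1.2 _
  have hΛL (q : 𝓑 × H × onbIndex G) := memLp_entryFn (hΛm q) (hΛfin q)
  have hLL := memLp_entryFn hLm hLfin
  let v : 𝓑 × H × onbIndex G → Lp ℝ 2 m := fun q => (hΛL q).toLp _
  let W : Submodule ℝ (Lp ℝ 2 m) := Submodule.span ℝ (range v)
  -- The closure of the span is its double orthogonal complement, so it suffices to test against
  -- every g orthogonal to the rank one fields.
  have hclos : hLL.toLp _ ∈ W.topologicalClosure := by
    rw [← Submodule.orthogonal_orthogonal_eq_closure, Submodule.mem_orthogonal]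
    intro g hg
    have hgq (q : 𝓑 × H × onbIndex G) : ⟪v q, g⟫ = 0 :=
      (Submodule.mem_orthogonal _ _).1 hg _ (Submodule.subset_span ⟨q, rfl⟩)
    have hgm : Measurable g := (Lp.stronglyMeasurable g).measurable
    have hgsq : ∀ᵐ z ∂μ, Summable fun k => g (z, k) ^ 2 := by
      have h1 : ∫⁻ p, ‖g p‖ₑ ^ 2 ∂m < ∞ := by
        have := lintegral_rpow_enorm_lt_top_of_eLpNorm_lt_top (by norm_num) (by norm_num)
          (Lp.memLp g).2
        simpa using this
      rw [lintegral_copies (hgm.enorm.pow_const 2)] at h1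
      have h2 : Measurable fun z => ∑' k, ‖g (z, k)‖ₑ ^ 2 :=
        Measurable.tsum fun k => (hgm.comp (measurable_id.prodMk measurable_const)).enorm.pow_const 2
      filter_upwards [ae_lt_top h2 h1.ne] with z hz
      refine (ENNReal.summable_toReal hz.ne).congr fun k => ?_
      rw [enorm_sq_eq_ofReal, ENNReal.toReal_ofReal (sq_nonneg _), Real.norm_eq_abs, sq_abs]
    have hint (Θ : Z → H →L[ℝ] G) (hΘ : MemLp (entryFn Θ) 2 m) :
        Integrable (fun z => ∑' k, entry (Θ z) k * g (z, k)) μ ∧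
          ⟪hΘ.toLp _, g⟫ = ∫ z, ∑' k, entry (Θ z) k * g (z, k) ∂μ := by
      have h1 : (fun p => ⟪hΘ.toLp _ p, g p⟫) =ᵐ[m] fun p => entryFn Θ p * g p := by
        filter_upwards [hΘ.coeFn_toLp] with p hp
        rw [hp]
        simp [mul_comm]
      have h2 := (integrable_congr h1).1 (L2.integrable_inner (𝕜 := ℝ) (hΘ.toLp _) g)
      have h3 := integral_copies h2
      refine ⟨h3.1, ?_⟩
      rw [L2.inner_def, integral_congr_ae h1, h3.2]
      rfl
    have hφ (h : H) (b : onbIndex G) :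
        ∀ᵐ z ∂μ, ∑' k, entry (rankOneOp h b ∘L R z) k * g (z, k) = 0 := by
      refine (hsep h (fun z => ∑' k, entry (rankOneOp h b ∘L R z) k * g (z, k))
        fun B hB => ?_).mono fun z hz => ?_
      · obtain ⟨h1, h2⟩ := hint _ (hΛL (⟨B, hB⟩, h, b))
        have h3 : (fun z => ∑' k, entry (Λ (⟨B, hB⟩, h, b) z) k * g (z, k)) =
            B.indicator fun z => ∑' k, entry (rankOneOp h b ∘L R z) k * g (z, k) := by
          ext z
          by_cases hz : z ∈ B
          · simp [Λ, hz]
          · simp [Λ, hz, entry]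
        rw [h3] at h1 h2
        rw [integral_indicator (h𝓑 B hB)] at h2
        exact ⟨(integrable_indicator_iff (h𝓑 B hB)).1 h1, h2.symm.trans (hgq _)⟩
      · by_cases hzh : R z h = 0
        · simp [entry_rankOneOp_comp (hR z), hzh]
        · exact hz hzh
    -- The exceptional null set depends on h, so h is confined to a countable dense set.
    have hφ' : ∀ᵐ z ∂μ, ∀ (n : ℕ) (b : onbIndex G),
        ∑' k, entry (rankOneOp (TopologicalSpace.denseSeq H n) b ∘L R z) k * g (z, k) = 0 :=
      ae_all_iff.2 fun n => ae_all_iff.2 fun b => hφ _ b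
    rw [real_inner_comm, (hint L hLL).2]
    refine integral_eq_zero_of_ae ?_
    filter_upwards [hgsq, hφ'] with z hz1 hz2
    refine tsum_mul_entry_eq_zero (hR z) (TopologicalSpace.denseRange_denseSeq H) hz1 ?_ (hL z)
      (hLker z)
    rintro _ ⟨n, rfl⟩ b
    exact hz2 n b
  obtain ⟨w, hw, hwε⟩ := EMetric.mem_closure_iff.1 hclos ε hε
  obtain ⟨n, c, f, rfl⟩ := Submodule.mem_span_set'.1 hw
  choose q hq using fun k => (f k).2
  -- The scalar coefficients of the span are absorbed into the rank one operators.
  refine ⟨n, fun k => (q k).1, fun k => c k • rankOneOp (q k).2.1 (q k).2.2, fun k => (q k).1.2,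
    fun k => (isHilbertSchmidt_rankOne _ _).smul _, ?_⟩
  set Ψ : Z → H →L[ℝ] G := fun z => L z - ∑ k, ((q k).1 : Set Z).indicator (1 : Z → ℝ) z •
    ((c k • rankOneOp (q k).2.1 (q k).2.2) ∘L R z) with hΨ
  have hΨe (z : Z) : Ψ z = L z - ∑ k, c k • Λ (q k) z := by
    simp only [hΨ, Λ, ContinuousLinearMap.smul_comp]
    congr 1
    exact Finset.sum_congr rfl fun k _ => smul_comm _ _ _
  have hΨm (x : H) (y : G) : Measurable fun z => ⟪Ψ z x, y⟫ := by
    simp only [hΨe, _root_.sub_apply, _root_.sum_apply, _root_.smul_apply, inner_sub_left,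
      sum_inner, inner_smul_left]
    exact (hLm x y).sub (Finset.measurable_sum _ fun k _ => measurable_const.mul (hΛm _ x y))
  rw [← eLpNorm_entryFn hΨm]
  rw [Lp.edist_def] at hwε
  refine lt_of_eq_of_lt (eLpNorm_congr_ae ?_) hwε
  have hcoe : ∀ᵐ p ∂m, ∀ k, (f k : Lp ℝ 2 m) p = entryFn (Λ (q k)) p := by
    refine ae_all_iff.2 fun k => ?_
    rw [← hq k]
    exact (hΛL (q k)).coeFn_toLp
  have hcoe2 : ∀ᵐ p ∂m, ∀ k, (c k • (f k : Lp ℝ 2 m)) p = c k * (f k : Lp ℝ 2 m) p :=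
    ae_all_iff.2 fun k => Lp.coeFn_smul (c k) (f k : Lp ℝ 2 m)
  filter_upwards [hLL.coeFn_toLp, Lp.coeFn_fun_finsetSum Finset.univ fun k => c k • (f k : Lp ℝ 2 m),
    hcoe, hcoe2] with p h1 h2 h3 h4
  rw [Pi.sub_apply, h1, h2]
  simp only [h4, h3, entryFn, hΨe, entry, _root_.sub_apply, _root_.sum_apply, _root_.smul_apply,
    inner_sub_right, inner_sum, inner_smul_right]

end Density

/-! ### The energy of the square root of the density -/

section Energy

variable {Ω : Type*} [mΩ : MeasurableSpace Ω] {P : Measure Ω}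
  {𝓕 : Filtration ℝ≥0 mΩ} {U : Type*} [mU : MeasurableSpace U] {𝒜 : Set (Set U)}
  {H : Type*} [NormedAddCommGroup H] [InnerProductSpace ℝ H]
  {M : ℝ≥0 → Set U → H → Ω → ℝ}

/-- The expected intensity is the second moment of the martingale. -/
theorem lintegral_intensity [IsProbabilityMeasure P] (hM : IsCylOrthMVM P 𝓕 𝒜 M) {x : H}
    {ν : Kernel Ω (ℝ≥0 × U)} (hν : IsIntensityMeasure P 𝓕 𝒜 M x ν) {A : Set U} (hA : A ∈ 𝒜) (t : ℝ≥0) :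
    ∫⁻ ω, ν ω (Icc 0 t ×ˢ A) ∂P = ∫⁻ ω, ‖M t A x ω‖ₑ ^ 2 ∂P := by
  obtain ⟨V, hV, hVt⟩ := hν.bracket A hA
  have hsq (t : ℝ≥0) : Integrable (fun ω => M t A x ω ^ 2) P :=
    ((hM.martingale A hA x).memLp t).integrable_sq
  have hdiff (t : ℝ≥0) : Integrable (fun ω => M t A x ω * M t A x ω - V t ω) P :=
    hV.martingale.integrable t
  have hVeq (t : ℝ≥0) : (fun ω => M t A x ω ^ 2 - (M t A x ω * M t A x ω - V t ω)) = V t := by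
    ext ω; ring
  have hVi : Integrable (V t) P := by
    rw [← hVeq]; exact (hsq t).sub (hdiff t)
  -- The martingale M² - V starts at 0.
  have h0 : ∫ ω, (M t A x ω * M t A x ω - V t ω) ∂P = 0 := by
    have h1 := hV.martingale.setIntegral_eq (zero_le (a := t)) MeasurableSet.univ
    simp only [Measure.restrict_univ] at h1
    refine Eq.trans h1.symm (integral_eq_zero_of_ae ?_)
    filter_upwards [hM.zero A hA x, hV.zero] with ω h2 h3
    simp [h2, h3]
  have hint : ∫ ω, V t ω ∂P = ∫ ω, M t A x ω ^ 2 ∂P := by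
    rw [← hVeq t, integral_sub (hsq t) (hdiff t), h0, sub_zero]
  have h1 : ∫⁻ ω, ν ω (Icc 0 t ×ˢ A) ∂P = ∫⁻ ω, ENNReal.ofReal (V t ω) ∂P :=
    lintegral_congr_ae ((hVt t).mono fun ω h => by beta_reduce; rw [← h.2, ENNReal.ofReal_toReal h.1])
  rw [h1, ← ofReal_integral_eq_lintegral_ofReal hVi
    ((hVt t).mono fun ω h => h.2 ▸ ENNReal.toReal_nonneg), hint,
    ofReal_integral_eq_lintegral_ofReal (hsq t) (ae_of_all _ fun ω => sq_nonneg _)]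
  refine lintegral_congr fun ω => ?_
  rw [enorm_sq_eq_ofReal, Real.norm_eq_abs, sq_abs]

theorem lintegral_intensity_zero [IsProbabilityMeasure P] (hM : IsCylOrthMVM P 𝓕 𝒜 M) {x : H}
    {ν : Kernel Ω (ℝ≥0 × U)} (hν : IsIntensityMeasure P 𝓕 𝒜 M x ν) {A : Set U} (hA : A ∈ 𝒜) :
    ∫⁻ ω, ν ω ({0} ×ˢ A) ∂P = 0 := by
  have h := lintegral_intensity hM hν hA 0
  rw [Icc_self] at h
  rw [h, lintegral_congr_ae (g := fun _ => 0)]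
  · simp
  · filter_upwards [hM.zero A hA x] with ω hω
    simp [hω]

variable [CompleteSpace H]

/-- By the closed graph theorem, `M(t, A)` is bounded from `H` to `L²`. -/
theorem exists_bound (hM : IsCylOrthMVM P 𝓕 𝒜 M) {A : Set U} (hA : A ∈ 𝒜) (t : ℝ≥0) :
    ∃ C : ℝ≥0, ∀ x, ∫⁻ ω, ‖M t A x ω‖ₑ ^ 2 ∂P ≤ C * ‖x‖ₑ ^ 2 := by
  have hL (x : H) : MemLp (M t A x) 2 P := (hM.martingale A hA x).memLp t
  let f : H →ₗ[ℝ] Lp ℝ 2 P :=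
    { toFun := fun x => (hL x).toLp _
      map_add' := fun x y => by
        rw [← MemLp.toLp_add]
        refine (MemLp.toLp_eq_toLp_iff _ _).2 ?_
        simpa using hM.linear t A hA 1 1 x y
      map_smul' := fun c x => by
        rw [RingHom.id_apply, ← MemLp.toLp_const_smul]
        refine (MemLp.toLp_eq_toLp_iff _ _).2 ?_
        simpa using hM.linear t A hA c 0 x 0 }
  have hf : Continuous f := by
    -- The graph is closed because the L² limit and the limit given by continuity in probability are
    -- both limits in measure.
    refine f.continuous_of_seq_closed_graph fun u x y hu hy => ?_
    have h1 : TendstoInMeasure P (fun n => M t A (u n)) atTop y :=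
      (tendstoInMeasure_of_tendsto_Lp hy).congr_left fun n => (hL (u n)).coeFn_toLp
    refine Lp.ext ?_
    exact (tendstoInMeasure_ae_unique h1 (hM.continuous t A hA u x hu)).trans
      (hL x).coeFn_toLp.symm
  let g : H →L[ℝ] Lp ℝ 2 P := ⟨f, hf⟩
  refine ⟨‖g‖₊ ^ 2, fun x => ?_⟩
  have h1 : ∫⁻ ω, ‖M t A x ω‖ₑ ^ 2 ∂P = ‖g x‖ₑ ^ 2 := by
    change _ = ‖(hL x).toLp _‖ₑ ^ 2
    rw [Lp.enorm_toLp, eLpNorm_eq_lintegral_rpow_enorm_toReal (by norm_num) (by norm_num),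
      ← ENNReal.rpow_natCast, ← ENNReal.rpow_mul]
    simp
  rw [h1, ENNReal.coe_pow, ← mul_pow]
  gcongr
  exact g.le_opENorm x

variable {T : ℝ≥0} {ν : H → Kernel Ω (ℝ≥0 × U)} {η : Kernel Ω (ℝ≥0 × U)}
  {Γ : Ω → VectorMeasure (Icc 0 T × U) (H →L[ℝ] H)} {Q : Ω → Icc 0 T → U → H →L[ℝ] H}

/-- The square root of the density `Q` at the point `z`. -/
abbrev sqrtAt (Q : Ω → Icc 0 T → U → H →L[ℝ] H) (z : Ω × Icc 0 T × U) : H →L[ℝ] H :=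
  posSqrt (Q z.1 z.2.1 z.2.2)

omit mΩ mU in
theorem sqrtAt_symm (z : Ω × Icc 0 T × U) (x y : H) :
    ⟪sqrtAt Q z x, y⟫ = ⟪x, sqrtAt Q z y⟫ :=
  (posSqrt_isPositive _).inner_left_eq_inner_right x y

/-- Polarization at x = y = h gives ⟪Γ(C) h, h⟫ = (ν_{h+h}(C) - ν_{h-h}(C)) / 4 ≤ ν_{h+h}(C). As Q
need not be positive everywhere, the estimate is made on the set where ⟪Q h, h⟫ ≥ 0; off that set
Q^{1/2} h vanishes. -/
theorem lintegral_sqrt_le_of_density {ω : Ω} {D : Set (Icc 0 T × U)} (hD : MeasurableSet D) {h : H}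
    (hQm : Measurable fun p : Icc 0 T × U => ⟪Q ω p.1 p.2 h, h⟫)
    (hΓ : ∀ C, MeasurableSet C →
      ⟪Γ ω C h, h⟫ = ((restrictTo T (ν (h + h) ω) C).toReal
        - (restrictTo T (ν (h - h) ω) C).toReal) / 4)
    (hQ : ∀ C, MeasurableSet C →
      IntegrableOn (fun p : Icc 0 T × U => ⟪Q ω p.1 p.2 h, h⟫) C (restrictTo T (η ω)) ∧
      ⟪Γ ω C h, h⟫ = ∫ p in C, ⟪Q ω p.1 p.2 h, h⟫ ∂(restrictTo T (η ω))) :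
    ∫⁻ p in D, ‖posSqrt (Q ω p.1 p.2) h‖ₑ ^ 2 ∂(restrictTo T (η ω)) ≤
      restrictTo T (ν (h + h) ω) D := by
  set q : Icc 0 T × U → ℝ := fun p => ⟪Q ω p.1 p.2 h, h⟫
  set E : Set (Icc 0 T × U) := {p | 0 ≤ q p}
  have hE : MeasurableSet E := measurableSet_le measurable_const hQm
  obtain ⟨h1, h2⟩ := hQ (D ∩ E) (hD.inter hE)
  calc ∫⁻ p in D, ‖posSqrt (Q ω p.1 p.2) h‖ₑ ^ 2 ∂(restrictTo T (η ω))
      ≤ ∫⁻ p in D, E.indicator (fun p => ENNReal.ofReal (q p)) p ∂(restrictTo T (η ω)) := by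
        refine lintegral_mono fun p => ?_
        rw [enorm_sq_eq_ofReal]
        refine (ENNReal.ofReal_le_ofReal (norm_posSqrt_sq_le (Q ω p.1 p.2) h)).trans ?_
        by_cases hp : p ∈ E
        · rw [indicator_of_mem hp, max_eq_left hp]
        · rw [max_eq_right (le_of_not_ge hp), ENNReal.ofReal_zero]; exact zero_le
    _ = ∫⁻ p in D ∩ E, ENNReal.ofReal (q p) ∂(restrictTo T (η ω)) := by
        rw [lintegral_indicator hE, Measure.restrict_restrict hE, inter_comm]
    _ = ENNReal.ofReal ⟪Γ ω (D ∩ E) h, h⟫ := by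
        rw [h2, ofReal_integral_eq_lintegral_ofReal h1]
        exact (ae_restrict_iff' (hD.inter hE)).2 (ae_of_all _ fun p hp => hp.2)
    _ ≤ ENNReal.ofReal (restrictTo T (ν (h + h) ω) (D ∩ E)).toReal := by
        refine ENNReal.ofReal_le_ofReal ?_
        rw [hΓ _ (hD.inter hE)]
        have h3 : 0 ≤ (restrictTo T (ν (h + h) ω) (D ∩ E)).toReal := ENNReal.toReal_nonneg
        have h4 : 0 ≤ (restrictTo T (ν (h - h) ω) (D ∩ E)).toReal := ENNReal.toReal_nonneg
        linarith
    _ ≤ restrictTo T (ν (h + h) ω) (D ∩ E) := ENNReal.ofReal_toReal_le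
    _ ≤ restrictTo T (ν (h + h) ω) D := measure_mono inter_subset_left

variable [TopologicalSpace.SeparableSpace H]

theorem measurable_sqrtAt [MeasurableSpace H] [BorelSpace H]
    (hQ : IsOperatorDensity P 𝓕 T η Γ Q) (h : H) :
    Measurable[predictableSigma 𝓕 T U] fun z => sqrtAt Q z h :=
  measurable_posSqrt_apply (mZ := predictableSigma 𝓕 T U) hQ.predictable h

/-- The energy of `Q^{1/2} h` on a set of the form `Ω × D`, for the Doléans measure, is bounded
by the expected intensity of `D`. -/
theorem setLIntegral_sqrt_le (hΓ : IsOperatorMeasure P T ν Γ) (hQ : IsOperatorDensity P 𝓕 T η Γ Q)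
    {D : Set (Icc 0 T × U)}
    (hD' : MeasurableSet[predictableSigma 𝓕 T U] {z : Ω × Icc 0 T × U | z.2 ∈ D})
    (hD : MeasurableSet D) (h : H) :
    ∫⁻ z in {z | z.2 ∈ D}, ‖sqrtAt Q z h‖ₑ ^ 2 ∂(doleans P 𝓕 T η) ≤
      ∫⁻ ω, ν (h + h) ω (Prod.map Subtype.val id '' D) ∂P := by
  let _ : MeasurableSpace H := borel H
  have : BorelSpace H := ⟨rfl⟩
  have hm : Measurable[predictableSigma 𝓕 T U] fun z : Ω × Icc 0 T × U =>
      {z : Ω × Icc 0 T × U | z.2 ∈ D}.indicator (fun z => ‖sqrtAt Q z h‖ₑ ^ 2) z :=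
    Measurable.indicator ((measurable_enorm.pow_const 2).comp (measurable_sqrtAt hQ h)) hD'
  rw [← lintegral_indicator hD', doleans, lintegral_trim _ hm]
  -- An upper bound suffices, so measurability of the family of measures being mixed is not needed.
  refine (Measure.lintegral_bind_le _ _ _).trans (lintegral_mono_ae ?_)
  filter_upwards [hΓ h h, hQ.density] with ω h1 h2
  have hω : Measurable (Prod.mk ω : Icc 0 T × U → Ω × Icc 0 T × U) := measurable_prodMk_left
  rw [lintegral_map (hm.mono (predictableSigma_le 𝓕 T) le_rfl) hω]
  have h3 : (fun p : Icc 0 T × U => {z : Ω × Icc 0 T × U | z.2 ∈ D}.indicator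
      (fun z => ‖sqrtAt Q z h‖ₑ ^ 2) (ω, p)) =
      D.indicator fun p => ‖posSqrt (Q ω p.1 p.2) h‖ₑ ^ 2 := by
    ext p
    by_cases hp : p ∈ D <;> simp [indicator, hp]
  rw [h3, lintegral_indicator hD]
  refine (lintegral_sqrt_le_of_density hD ?_ h1 (h2 h h)).trans
    (Measure.comap_apply_le _ _ hD.nullMeasurableSet)
  exact ((hQ.predictable h h).mono (predictableSigma_le 𝓕 T) le_rfl).comp hω

theorem measurableSet_snd {A : Set U} (hA : MeasurableSet A) :
    MeasurableSet[predictableSigma 𝓕 T U] {z : Ω × Icc 0 T × U | z.2.2 ∈ A} :=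
  (le_sup_right : _ ≤ predictableSigma 𝓕 T U) _ ⟨A, hA, rfl⟩

theorem measurableSet_fst {E : Set (ℝ≥0 × Ω)} (hE : MeasurableSet[𝓕.predictable] E) :
    MeasurableSet[predictableSigma 𝓕 T U] {z : Ω × Icc 0 T × U | ((z.2.1 : ℝ≥0), z.1) ∈ E} :=
  (le_sup_left : _ ≤ predictableSigma 𝓕 T U) _ ⟨E, hE, rfl⟩

/-- The energy of `Q^{1/2} h` on `Ω × [0, T] × A` is at most the square of the norm of `h`, up to a
constant. -/
theorem exists_energy_bound [IsProbabilityMeasure P] (hM : IsCylOrthMVM P 𝓕 𝒜 M)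
    (h𝒜 : ∀ A ∈ 𝒜, MeasurableSet A)
    (hν : ∀ x, IsIntensityMeasure P 𝓕 𝒜 M x (ν x))
    (hΓ : IsOperatorMeasure P T ν Γ) (hQ : IsOperatorDensity P 𝓕 T η Γ Q) {A : Set U}
    (hA : A ∈ 𝒜) : ∃ C : ℝ≥0, ∀ h,
      ∫⁻ z in {z | z.2.2 ∈ A}, ‖sqrtAt Q z h‖ₑ ^ 2 ∂(doleans P 𝓕 T η) ≤ C * ‖h‖ₑ ^ 2 := by
  obtain ⟨C, hC⟩ := exists_bound hM hA T
  -- The 4 is ‖h + h‖² / ‖h‖², from the h + h of the polarization formula.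
  refine ⟨C * 4, fun h => ?_⟩
  refine (setLIntegral_sqrt_le (D := {p | p.2 ∈ A}) hΓ hQ (measurableSet_snd (h𝒜 A hA))
    (measurable_snd (h𝒜 A hA)) h).trans ?_
  have h1 : Prod.map Subtype.val id '' {p : Icc 0 T × U | p.2 ∈ A} ⊆ Icc 0 T ×ˢ A := by
    rintro _ ⟨p, hp, rfl⟩
    exact ⟨p.1.2, hp⟩
  refine (lintegral_mono fun ω => measure_mono h1).trans ?_
  rw [lintegral_intensity hM (hν (h + h)) hA]
  refine (hC _).trans_eq ?_
  rw [← two_smul ℝ h, enorm_smul, mul_pow, ENNReal.coe_mul, mul_assoc]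
  congr 2
  rw [enorm_sq_eq_ofReal]
  norm_num

/-- The intervals (s,t] never contain 0, so simple integrands cannot resolve time 0. Nothing is
lost, since M(0,A) = 0 leaves no expected intensity, hence no energy, there. -/
theorem sqrtAt_eq_zero_at_zero [IsProbabilityMeasure P] (hM : IsCylOrthMVM P 𝓕 𝒜 M)
    (h𝒜 : ∀ A ∈ 𝒜, MeasurableSet A)
    (hν : ∀ x, IsIntensityMeasure P 𝓕 𝒜 M x (ν x))
    (hΓ : IsOperatorMeasure P T ν Γ) (hQ : IsOperatorDensity P 𝓕 T η Γ Q) {A : Set U}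
    (hA : A ∈ 𝒜) (h : H) :
    ∀ᵐ z ∂(doleans P 𝓕 T η), (z.2.1 : ℝ≥0) = 0 → z.2.2 ∈ A → sqrtAt Q z h = 0 := by
  let _ : MeasurableSpace H := borel H
  have : BorelSpace H := ⟨rfl⟩
  set D : Set (Icc 0 T × U) := {p | (p.1 : ℝ≥0) = 0 ∧ p.2 ∈ A} with hDdef
  have hD : MeasurableSet D :=
    ((measurableSet_singleton (0 : ℝ≥0)).preimage (measurable_subtype_coe.comp measurable_fst)).inter
      (measurable_snd (h𝒜 A hA))
  have hD' : MeasurableSet[predictableSigma 𝓕 T U] {z : Ω × Icc 0 T × U | z.2 ∈ D} := by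
    have h1 := measurableSet_fst (T := T) (U := U)
      (measurableSet_predictable_singleton_bot_prod (𝓕 := 𝓕) (s := univ) MeasurableSet.univ)
    refine MeasurableSet.congr (h1.inter (measurableSet_snd (h𝒜 A hA))) ?_
    ext z
    simp [hDdef]
  have h0 : ∫⁻ z in {z | z.2 ∈ D}, ‖sqrtAt Q z h‖ₑ ^ 2 ∂(doleans P 𝓕 T η) = 0 := by
    refine le_antisymm ((setLIntegral_sqrt_le hΓ hQ hD' hD h).trans ?_) zero_le
    rw [← lintegral_intensity_zero hM (hν (h + h)) hA]
    refine lintegral_mono fun ω => measure_mono ?_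
    rintro _ ⟨p, hp, rfl⟩
    exact hp
  have hm : Measurable[predictableSigma 𝓕 T U] fun z : Ω × Icc 0 T × U => ‖sqrtAt Q z h‖ₑ ^ 2 :=
    (measurable_enorm.pow_const 2).comp (measurable_sqrtAt hQ h)
  rw [lintegral_eq_zero_iff hm] at h0
  filter_upwards [(ae_restrict_iff' hD').1 h0] with z hz h1 h2
  simpa using hz ⟨h1, h2⟩

end Energy

/-! ### Predictable boxes -/

/-- The integral over the whole space is a separate hypothesis because 𝒞 need not contain it; it is
what handles complements in the π-λ induction. -/
theorem ae_eq_zero_of_isPiSystem {Z : Type*} {mZ : MeasurableSpace Z} {μ : Measure Z} {φ : Z → ℝ}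
    (hφ : Integrable φ μ) {𝒞 : Set (Set Z)} (hgen : mZ = MeasurableSpace.generateFrom 𝒞)
    (h𝒞 : IsPiSystem 𝒞) (huniv : ∫ z, φ z ∂μ = 0) (h0 : ∀ C ∈ 𝒞, ∫ z in C, φ z ∂μ = 0) :
    φ =ᵐ[μ] 0 := by
  have h (s : Set Z) (hs : MeasurableSet s) : ∫ z in s, φ z ∂μ = 0 := by
    induction s, hs using MeasurableSpace.induction_on_inter hgen h𝒞 with
    | empty => simp
    | basic t ht => exact h0 t ht
    | compl t htm ih =>
      have := integral_add_compl htm hφ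
      rwa [ih, zero_add, huniv] at this
    | iUnion f hd hm ih =>
      rw [integral_iUnion hm hd hφ.integrableOn]
      simp [ih]
  exact hφ.ae_eq_zero_of_forall_setIntegral_eq_zero fun s hs _ => h s hs

section Boxes

variable {Ω : Type*} [mΩ : MeasurableSpace Ω] {P : Measure Ω}
  {𝓕 : Filtration ℝ≥0 mΩ} {U : Type*} [mU : MeasurableSpace U] {𝒜 : Set (Set U)} {T : ℝ≥0}

/-- The sets that generate the predictable `σ`-algebra. -/
def predictableGen (𝓕 : Filtration ℝ≥0 mΩ) : Set (Set (ℝ≥0 × Ω)) :=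
  {E | (∃ F, MeasurableSet[𝓕 0] F ∧ E = {0} ×ˢ F) ∨
    ∃ s F, MeasurableSet[𝓕 s] F ∧ E = Ioi s ×ˢ F}

theorem generateFrom_predictableGen :
    MeasurableSpace.generateFrom (predictableGen 𝓕) = 𝓕.predictable := by
  refine le_antisymm (MeasurableSpace.generateFrom_le ?_)
    (measurableSpace_le_predictable_of_measurableSet ?_ ?_)
  · rintro _ (⟨F, hF, rfl⟩ | ⟨s, F, hF, rfl⟩)
    · exact measurableSet_predictable_singleton_bot_prod hF
    · exact measurableSet_predictable_Ioi_prod hF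
  · exact fun F hF => MeasurableSpace.measurableSet_generateFrom (Or.inl ⟨F, hF, rfl⟩)
  · exact fun s F hF => MeasurableSpace.measurableSet_generateFrom (Or.inr ⟨s, F, hF, rfl⟩)

theorem isPiSystem_predictableGen : IsPiSystem (predictableGen 𝓕) := by
  rintro _ (⟨F, hF, rfl⟩ | ⟨s, F, hF, rfl⟩) _ (⟨F', hF', rfl⟩ | ⟨s', F', hF', rfl⟩) hne
  · exact Or.inl ⟨F ∩ F', hF.inter hF', by rw [prod_inter_prod, inter_self]⟩
  · obtain ⟨⟨t, ω⟩, ⟨h1, -⟩, h2, -⟩ := hne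
    have h1' : t = 0 := h1
    have h2' : s' < t := h2
    exact absurd h2' (by simp [h1'])
  · obtain ⟨⟨t, ω⟩, ⟨h1, -⟩, h2, -⟩ := hne
    have h1' : t = 0 := h2
    have h2' : s < t := h1
    exact absurd h2' (by simp [h1'])
  · refine Or.inr ⟨max s s', F ∩ F', ?_, by rw [prod_inter_prod, Ioi_inter_Ioi]⟩
    exact (𝓕.mono (le_max_left s s') _ hF).inter (𝓕.mono (le_max_right s s') _ hF')

theorem isCountablySpanning_predictableGen : IsCountablySpanning (predictableGen 𝓕) := by
  refine ⟨fun n => if n = 0 then {0} ×ˢ univ else Ioi 0 ×ˢ univ, fun n => ?_, ?_⟩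
  · dsimp only
    split_ifs
    · exact Or.inl ⟨univ, MeasurableSet.univ, rfl⟩
    · exact Or.inr ⟨0, univ, MeasurableSet.univ, rfl⟩
  · refine eq_univ_of_forall fun p => mem_iUnion.2 ?_
    obtain hp | hp := eq_zero_or_pos p.1
    · exact ⟨0, by simp [hp]⟩
    · exact ⟨1, by simpa using hp⟩

/-- The generating boxes of the `σ`-algebra `𝒫_T ⊗ ℬ(U)`. -/
def boxGen (𝓕 : Filtration ℝ≥0 mΩ) (T : ℝ≥0) (U : Type*) [MeasurableSpace U] :
    Set (Set (Ω × Icc 0 T × U)) :=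
  preimage (fun z : Ω × Icc 0 T × U => (((z.2.1 : ℝ≥0), z.1), z.2.2)) ''
    image2 (· ×ˢ ·) (predictableGen 𝓕) {A : Set U | MeasurableSet A}

theorem generateFrom_boxGen :
    predictableSigma 𝓕 T U = MeasurableSpace.generateFrom (boxGen 𝓕 T U) := by
  -- The product with U is to be formed with the predictable σ-algebra, not the product one on ℝ≥0 ×
  -- Ω.
  let _ : MeasurableSpace (ℝ≥0 × Ω) := 𝓕.predictable
  rw [boxGen, ← MeasurableSpace.comap_generateFrom,
    generateFrom_eq_prod (generateFrom_predictableGen (𝓕 := 𝓕))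
      (MeasurableSpace.generateFrom_measurableSet (α := U))
      isCountablySpanning_predictableGen isCountablySpanning_measurableSet,
    Prod.instMeasurableSpace, MeasurableSpace.prod, MeasurableSpace.comap_sup,
    MeasurableSpace.comap_comp, MeasurableSpace.comap_comp]
  rfl

theorem isPiSystem_boxGen : IsPiSystem (boxGen 𝓕 T U) := by
  have := (isPiSystem_predictableGen.prod
    MeasurableSpace.isPiSystem_measurableSet).comap (S := image2 (· ×ˢ ·) (predictableGen 𝓕)
      {A : Set U | MeasurableSet A}) (fun z : Ω × Icc 0 T × U => (((z.2.1 : ℝ≥0), z.1), z.2.2))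
  exact this

/-- The set `{(ω, r, u) | r ∈ (s, t], ω ∈ F, u ∈ A}`. -/
def box (T s t : ℝ≥0) (F : Set Ω) (A : Set U) : Set (Ω × Icc 0 T × U) :=
  {z | (z.2.1 : ℝ≥0) ∈ Ioc s t ∧ z.1 ∈ F ∧ z.2.2 ∈ A}

omit mΩ mU in
theorem indicator_box (s t : ℝ≥0) (F : Set Ω) (A : Set U) (ω : Ω) (r : Icc 0 T) (u : U) :
    (Ioc s t).indicator (1 : ℝ≥0 → ℝ) r * F.indicator (1 : Ω → ℝ) ω * A.indicator (1 : U → ℝ) u =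
      (box T s t F A).indicator (1 : Ω × Icc 0 T × U → ℝ) (ω, r, u) := by
  classical
  simp only [indicator_apply, box, mem_ofPred_eq, Pi.one_apply]
  split_ifs <;> simp_all

/-- The boxes on which the simple integrands are built. -/
def simpleBoxes (𝓕 : Filtration ℝ≥0 mΩ) (𝒜 : Set (Set U)) (T : ℝ≥0) :
    Set (Set (Ω × Icc 0 T × U)) :=
  {B | ∃ s t F A, s ≤ t ∧ MeasurableSet[𝓕 s] F ∧ A ∈ 𝒜 ∧ B = box T s t F A}

theorem measurableSet_box {s t : ℝ≥0} {F : Set Ω} {A : Set U} (hF : MeasurableSet[𝓕 s] F)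
    (hA : MeasurableSet A) : MeasurableSet[predictableSigma 𝓕 T U] (box T s t F A) := by
  refine MeasurableSet.congr ((measurableSet_fst (T := T) (U := U)
    (measurableSet_predictable_Ioc_prod s t hF)).inter (measurableSet_snd hA)) ?_
  ext z
  simp [box, and_assoc]

/-- A function whose integrals over the boxes vanish is zero at positive times. -/
theorem ae_eq_zero_of_simpleBoxes (h𝒜 : ∀ A ∈ 𝒜, MeasurableSet A) {V : Set U}
    (hV : ∀ B ⊆ V, MeasurableSet B → B ∈ 𝒜) (hV𝒜 : V ∈ 𝒜)
    {μ : @Measure (Ω × Icc 0 T × U) (predictableSigma 𝓕 T U)} {φ : Ω × Icc 0 T × U → ℝ}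
    (hφ : ∀ B ∈ simpleBoxes 𝓕 𝒜 T, IntegrableOn φ B μ ∧ ∫ z in B, φ z ∂μ = 0) :
    ∀ᵐ z ∂μ, 0 < (z.2.1 : ℝ≥0) → z.2.2 ∈ V → φ z = 0 := by
  set Z₀ : Set (Ω × Icc 0 T × U) := box T 0 T univ V with hZ₀
  have hZ₀m : MeasurableSet[predictableSigma 𝓕 T U] Z₀ :=
    measurableSet_box MeasurableSet.univ (h𝒜 V hV𝒜)
  obtain ⟨hi, h0⟩ := hφ Z₀ ⟨0, T, univ, V, zero_le, MeasurableSet.univ, hV𝒜, rfl⟩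
  -- On Z₀, the part over (0,T] × V, φ is integrable and the traces of the generating boxes are
  -- empty or simple boxes.
  have key : φ =ᵐ[μ.restrict Z₀] 0 := by
    refine ae_eq_zero_of_isPiSystem hi generateFrom_boxGen isPiSystem_boxGen h0 ?_
    rintro _ ⟨_, ⟨E, hE, A, hA, rfl⟩, rfl⟩
    have hEm : MeasurableSet[𝓕.predictable] E := by
      rw [← generateFrom_predictableGen]
      exact MeasurableSpace.measurableSet_generateFrom hE
    have hm : MeasurableSet[predictableSigma 𝓕 T U]
        ((fun z : Ω × Icc 0 T × U => (((z.2.1 : ℝ≥0), z.1), z.2.2)) ⁻¹' (E ×ˢ A)) :=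
      (measurableSet_fst hEm).inter (measurableSet_snd hA)
    rw [Measure.restrict_restrict hm]
    obtain ⟨F, hF, rfl⟩ | ⟨s, F, hF, rfl⟩ := hE
    · convert setIntegral_empty
      refine eq_empty_of_forall_notMem fun z hz => ?_
      have h1 : (z.2.1 : ℝ≥0) = 0 := hz.1.1.1
      exact absurd hz.2.1.1 (by simp [h1])
    -- The right end is max s T since s may exceed T, and a simple box requires s ≤ t. Intersecting
    -- with V puts the set in 𝒜.
    · refine (hφ _ ⟨s, max s T, F, A ∩ V, le_max_left _ _, hF,
        hV _ inter_subset_right (hA.inter (h𝒜 V hV𝒜)), ?_⟩).2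
      ext z
      have h1 : (z.2.1 : ℝ≥0) ≤ T := z.2.1.2.2
      have h2 : s < z.2.1 → 0 < (z.2.1 : ℝ≥0) := fun h => zero_le.trans_lt h
      simp only [hZ₀, box, mem_inter_iff, mem_preimage, mem_prod, mem_Ioi, mem_Ioc, mem_ofPred_eq,
        mem_univ, true_and, h1, and_true, le_max_iff, or_true]
      tauto
  filter_upwards [(ae_restrict_iff' hZ₀m).1 key] with z hz h1 h2
  exact hz ⟨⟨h1, z.2.1.2.2⟩, mem_univ _, h2⟩

end Boxes

/-! ### Simple integrands -/

section Measurability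

variable {Z : Type*} {mZ : MeasurableSpace Z} {H : Type*} [NormedAddCommGroup H]
  [MeasurableSpace H] [BorelSpace H]

theorem measurable_tsum_enorm_sq {ι : Type*} [Countable ι] {f : ι → Z → H}
    (hf : ∀ i, Measurable (f i)) : Measurable fun z => ∑' i, ‖f i z‖ₑ ^ 2 :=
  Measurable.tsum fun i => (hf i).enorm.pow_const 2

theorem measurable_inner_sum_indicator [InnerProductSpace ℝ H] {G : Type*} [NormedAddCommGroup G]
    [InnerProductSpace ℝ G] {R : Z → H →L[ℝ] H} (hR : ∀ x, Measurable fun z => R z x)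
    {ι : Type*} [Fintype ι] {B : ι → Set Z} (hB : ∀ k, MeasurableSet (B k))
    (S : ι → H →L[ℝ] G) (x : H) (y : G) :
    Measurable fun z => ⟪y, (∑ k, (B k).indicator (1 : Z → ℝ) z • (S k ∘L R z)) x⟫ := by
  simp only [_root_.sum_apply, _root_.smul_apply, inner_sum, inner_smul_right,
    ContinuousLinearMap.comp_apply]
  refine Finset.measurable_sum _ fun k _ => (measurable_one.indicator (hB k)).mul ?_
  have h : Measurable fun v : H => ⟪y, S k v⟫ :=
    (continuous_const.inner (S k).continuous).measurable
  exact h.comp (hR x)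

end Measurability

/-! ### Simple integrands belong to Λ² and are dense in it -/

section Integrands

open ContinuousLinearMap

variable {Ω : Type*} [mΩ : MeasurableSpace Ω] {P : Measure Ω} [IsProbabilityMeasure P]
  {𝓕 : Filtration ℝ≥0 mΩ} {U : Type*} [mU : MeasurableSpace U] {𝒜 : Set (Set U)}
  {H : Type*} [NormedAddCommGroup H] [InnerProductSpace ℝ H] [CompleteSpace H]
  [TopologicalSpace.SeparableSpace H]
  {G : Type*} [NormedAddCommGroup G] [InnerProductSpace ℝ G] [CompleteSpace G]
  [TopologicalSpace.SeparableSpace G]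
  {M : ℝ≥0 → Set U → H → Ω → ℝ} {T : ℝ≥0} {ν : H → Kernel Ω (ℝ≥0 × U)} {η : Kernel Ω (ℝ≥0 × U)}
  {Γ : Ω → VectorMeasure (Icc 0 T × U) (H →L[ℝ] H)} {Q : Ω → Icc 0 T → U → H →L[ℝ] H}

omit [TopologicalSpace.SeparableSpace H] in
theorem toImage_eq_zero {R : H →L[ℝ] H} {x : H} (hx : R x = 0) : toImage R x = 0 :=
  Subtype.ext ((toImage_eq R x).trans hx)

omit mΩ mU [TopologicalSpace.SeparableSpace H] [TopologicalSpace.SeparableSpace G] in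
-- Self-adjointness of Q^{1/2} moves it onto the vectors S* b, which turns operator energies into
-- sums of vector energies.
theorem hsNormSq_comp_sqrtAt (S : H →L[ℝ] G) (z : Ω × Icc 0 T × U) :
    hsNormSq (S ∘L sqrtAt Q z) = ∑' b : onbIndex G, ‖sqrtAt Q z (adjoint S (onb G b))‖ₑ ^ 2 := by
  rw [hsNormSq_eq_tsum_adjoint, adjoint_comp, (posSqrt_isPositive _).isSelfAdjoint.adjoint_eq]
  rfl

/-- The energy of a constant Hilbert-Schmidt operator on `Ω × [0, T] × A` is finite. -/
theorem setLIntegral_hsNormSq_lt_top (hM : IsCylOrthMVM P 𝓕 𝒜 M)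
    (h𝒜 : ∀ A ∈ 𝒜, MeasurableSet A) (hν : ∀ x, IsIntensityMeasure P 𝓕 𝒜 M x (ν x))
    (hΓ : IsOperatorMeasure P T ν Γ) (hQ : IsOperatorDensity P 𝓕 T η Γ Q) {A : Set U}
    (hA : A ∈ 𝒜) {S : H →L[ℝ] G} (hS : IsHilbertSchmidt S) :
    ∫⁻ z in {z | z.2.2 ∈ A}, hsNormSq (S ∘L sqrtAt Q z) ∂(doleans P 𝓕 T η) < ∞ := by
  let _ : MeasurableSpace H := borel H
  have : BorelSpace H := ⟨rfl⟩
  obtain ⟨C, hC⟩ := exists_energy_bound hM h𝒜 hν hΓ hQ hA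
  have hm (h : H) : Measurable[predictableSigma 𝓕 T U] fun z => ‖sqrtAt Q z h‖ₑ ^ 2 :=
    (measurable_enorm.pow_const 2).comp (measurable_sqrtAt hQ h)
  simp_rw [hsNormSq_comp_sqrtAt]
  rw [lintegral_tsum fun b => (hm _).aemeasurable]
  -- The bounds C ‖S* b‖² add up to C times the squared Hilbert–Schmidt norm of S.
  refine (ENNReal.tsum_le_tsum fun b => hC _).trans_lt ?_
  rw [ENNReal.tsum_mul_left, ← hsNormSq_eq_tsum_adjoint]
  exact ENNReal.mul_lt_top ENNReal.coe_lt_top hS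

omit mΩ mU [IsProbabilityMeasure P] [TopologicalSpace.SeparableSpace H] [CompleteSpace G]
  [TopologicalSpace.SeparableSpace G] in
-- The factorization of Q^{1/2} through H_Q cancels the restriction of S to H_Q, leaving exactly the
-- fields of `exists_simple_approx`.
theorem compSqrt_simple {Ψ : Family Q G} {n m : ℕ} {s t : Fin n → ℝ≥0} {F : Fin n → Set Ω}
    {A : Fin m → Set U} {S : Fin n → Fin m → H →L[ℝ] G}
    (hΨ : ∀ ω r u, Ψ ω r u = ∑ i, ∑ j,
      ((Ioc (s i) (t i)).indicator (1 : ℝ≥0 → ℝ) r * (F i).indicator (1 : Ω → ℝ) ω *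
        (A j).indicator (1 : U → ℝ) u) • (S i j ∘L inclusion (posSqrt (Q ω r u))))
    (z : Ω × Icc 0 T × U) :
    compSqrt Ψ z = ∑ k : Fin n × Fin m,
      (box T (s k.1) (t k.1) (F k.1) (A k.2)).indicator (1 : Ω × Icc 0 T × U → ℝ) z •
        (S k.1 k.2 ∘L sqrtAt Q z) := by
  obtain ⟨ω, r, u⟩ := z
  rw [Fintype.sum_prod_type, compSqrt, hΨ]
  ext x
  simp only [comp_apply, _root_.sum_apply, _root_.smul_apply, indicator_box]
  refine Finset.sum_congr rfl fun i _ => Finset.sum_congr rfl fun j _ => ?_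
  rw [inclusion_eq, toImage_eq]

theorem IsSimple.memLambda (hM : IsCylOrthMVM P 𝓕 𝒜 M)
    (h𝒜 : ∀ A ∈ 𝒜, MeasurableSet A) (hν : ∀ x, IsIntensityMeasure P 𝓕 𝒜 M x (ν x))
    (hΓ : IsOperatorMeasure P T ν Γ) (hQ : IsOperatorDensity P 𝓕 T η Γ Q) {Ψ : Family Q G}
    (hΨ : IsSimple 𝓕 𝒜 Ψ) : MemLambda P 𝓕 η Ψ := by
  obtain ⟨n, m, s, t, F, A, S, hst, hF, hA, hS, hΨ⟩ := hΨ
  have hB (k : Fin n × Fin m) : MeasurableSet[predictableSigma 𝓕 T U]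
      (box T (s k.1) (t k.1) (F k.1) (A k.2)) := measurableSet_box (hF _) (h𝒜 _ (hA _))
  refine ⟨fun ω r u => ?_, fun h => ?_, ?_⟩
  · rw [hΨ]
    exact IsHilbertSchmidt.sum fun i _ => IsHilbertSchmidt.sum fun j _ =>
      ((hS i j).comp _).smul _
  · let _ : MeasurableSpace G := borel G
    have : BorelSpace G := ⟨rfl⟩
    refine measurable_of_inner (mZ := predictableSigma 𝓕 T U) fun y => ?_
    simp_rw [compSqrt_simple hΨ]
    let _ : MeasurableSpace H := borel H
    have : BorelSpace H := ⟨rfl⟩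
    exact measurable_inner_sum_indicator (measurable_sqrtAt hQ) hB _ h y
  · refine ENNReal.rpow_lt_top_of_nonneg (by norm_num) (ne_of_lt ?_)
    have h1 (z : Ω × Icc 0 T × U) : hsNormSq (compSqrt Ψ z) ≤
        (Finset.univ : Finset (Fin n × Fin m)).card * ∑ k : Fin n × Fin m,
          {z : Ω × Icc 0 T × U | z.2.2 ∈ A k.2}.indicator
            (fun z => hsNormSq (S k.1 k.2 ∘L sqrtAt Q z)) z := by
      rw [compSqrt_simple hΨ]
      refine (hsNormSq_sum_le _ _).trans ?_
      gcongr with k _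
      by_cases hz : z ∈ box T (s k.1) (t k.1) (F k.1) (A k.2)
      · rw [indicator_of_mem hz, indicator_of_mem (by exact hz.2.2)]
        simp
      · rw [indicator_of_notMem hz, zero_smul, hsNormSq_zero]
        exact zero_le
    refine (lintegral_mono h1).trans_lt ?_
    let _ : MeasurableSpace H := borel H
    have : BorelSpace H := ⟨rfl⟩
    have hm (S : H →L[ℝ] G) : Measurable[predictableSigma 𝓕 T U]
        fun z => hsNormSq (S ∘L sqrtAt Q z) := by
      simp_rw [hsNormSq_comp_sqrtAt]
      exact measurable_tsum_enorm_sq fun b => measurable_sqrtAt hQ _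
    have hAm (k : Fin n × Fin m) : MeasurableSet[predictableSigma 𝓕 T U]
        {z : Ω × Icc 0 T × U | z.2.2 ∈ A k.2} := measurableSet_snd (h𝒜 _ (hA _))
    rw [lintegral_const_mul' _ _ (ENNReal.natCast_ne_top _),
      lintegral_finsetSum _ fun k _ => (hm _).indicator (hAm k)]
    refine ENNReal.mul_lt_top (ENNReal.natCast_lt_top _) (ENNReal.sum_lt_top.2 fun k _ => ?_)
    rw [lintegral_indicator (hAm k)]
    exact setLIntegral_hsNormSq_lt_top hM h𝒜 hν hΓ hQ (hA _) (hS _ _)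

theorem exists_isSimple_lt (hM : IsCylOrthMVM P 𝓕 𝒜 M)
    (h𝒜 : ∀ A ∈ 𝒜, MeasurableSet A) (hν : ∀ x, IsIntensityMeasure P 𝓕 𝒜 M x (ν x))
    (hΓ : IsOperatorMeasure P T ν Γ) (hQ : IsOperatorDensity P 𝓕 T η Γ Q) (hT : 0 < T)
    {Φ : Family Q G} (hΦ : MemLambda P 𝓕 η Φ) {ε : ℝ≥0∞} (hε : 0 < ε) :
    ∃ Ψ : Family Q G, IsSimple 𝓕 𝒜 Ψ ∧ lambdaNorm P 𝓕 η (Φ - Ψ) < ε := by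
  let _ : MeasurableSpace H := borel H
  have : BorelSpace H := ⟨rfl⟩
  let _ : MeasurableSpace G := borel G
  have : BorelSpace G := ⟨rfl⟩
  -- Only the exhaustion of U is needed, so any vector serves, here 0; the L²-measure property is
  -- available only at positive times, whence T > 0.
  obtain ⟨V, hVm, -, hVu, hV𝒜, -⟩ := (hM.l2Measure T hT 0).sigmaFinite
  have hV (n : ℕ) : V n ∈ 𝒜 := hV𝒜 n _ subset_rfl (hVm n)
  have hsep (h : H) (φ : Ω × Icc 0 T × U → ℝ)
      (hφ : ∀ B ∈ simpleBoxes 𝓕 𝒜 T, IntegrableOn φ B (doleans P 𝓕 T η) ∧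
        ∫ z in B, φ z ∂(doleans P 𝓕 T η) = 0) :
      ∀ᵐ z ∂(doleans P 𝓕 T η), sqrtAt Q z h ≠ 0 → φ z = 0 := by
    filter_upwards [ae_all_iff.2 fun n => ae_eq_zero_of_simpleBoxes h𝒜 (hV𝒜 n) (hV n) hφ,
      ae_all_iff.2 fun n => sqrtAt_eq_zero_at_zero hM h𝒜 hν hΓ hQ (hV n) h] with z h1 h2 h3
    obtain ⟨n, hn⟩ := mem_iUnion.1 (hVu ▸ mem_univ z.2.2)
    obtain h0 | h0 := eq_zero_or_pos (z.2.1 : ℝ≥0)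
    · exact absurd (h2 n h0 hn) h3
    · exact h1 n h0 hn
  have hfin (B : Set (Ω × Icc 0 T × U)) (hB : B ∈ simpleBoxes 𝓕 𝒜 T) (h : H) :
      ∫⁻ z in B, ‖sqrtAt Q z h‖ₑ ^ 2 ∂(doleans P 𝓕 T η) < ∞ := by
    obtain ⟨s, t, F, A, -, hF, hA, rfl⟩ := hB
    obtain ⟨C, hC⟩ := exists_energy_bound hM h𝒜 hν hΓ hQ hA
    refine ((lintegral_mono_set fun z hz => hz.2.2).trans (hC h)).trans_lt ?_
    exact ENNReal.mul_lt_top ENNReal.coe_lt_top (by simp)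
  have hRm (x y : H) : Measurable[predictableSigma 𝓕 T U] fun z => ⟪sqrtAt Q z x, y⟫ :=
    (continuous_id.inner continuous_const).measurable.comp (measurable_sqrtAt hQ x)
  have hLm (x : H) (y : G) : Measurable[predictableSigma 𝓕 T U] fun z => ⟪compSqrt Φ z x, y⟫ :=
    (continuous_id.inner continuous_const).measurable.comp (hΦ.predictable x)
  have hLfin : ∫⁻ z, hsNormSq (compSqrt Φ z) ∂(doleans P 𝓕 T η) < ∞ := by
    have := hΦ.norm_lt
    rwa [lambdaNorm, ENNReal.rpow_lt_top_iff_of_pos (by norm_num)] at this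
  obtain ⟨n, B, S, hB, hS, hlt⟩ := exists_simple_approx (mZ := predictableSigma 𝓕 T U)
    (R := sqrtAt Q) (L := compSqrt Φ) (μ := doleans P 𝓕 T η) (𝓑 := simpleBoxes 𝓕 𝒜 T) hRm
    sqrtAt_symm (by
      rintro _ ⟨s, t, F, A, -, hF, hA, rfl⟩
      exact measurableSet_box hF (h𝒜 A hA)) hfin hsep hLm
    (fun z x hx => by rw [compSqrt, comp_apply, toImage_eq_zero hx, map_zero])
    (fun z => (hΦ.hilbertSchmidt z.1 z.2.1 z.2.2).comp _) hLfin hε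
  choose s t F A hst hF hA hBe using hB
  -- The approximation is a single sum over boxes; a diagonal matrix of operators puts it into the
  -- double sum form.
  let Ψ : Family Q G := fun ω r u => ∑ i, ∑ j,
    ((Ioc (s i) (t i)).indicator (1 : ℝ≥0 → ℝ) r * (F i).indicator (1 : Ω → ℝ) ω *
      (A j).indicator (1 : U → ℝ) u) • ((if i = j then S i else 0) ∘L
        inclusion (posSqrt (Q ω r u)))
  refine ⟨Ψ, ⟨n, n, s, t, F, A, fun i j => if i = j then S i else 0, hst, hF, hA, fun i j => ?_,
    fun _ _ _ => rfl⟩, ?_⟩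
  · beta_reduce
    split_ifs
    · exact hS i
    · simp [IsHilbertSchmidt, hsNormSq_zero]
  · refine lt_of_eq_of_lt ?_ hlt
    rw [lambdaNorm]
    congr 1
    refine lintegral_congr fun z => ?_
    congr 1
    have h1 : compSqrt (Φ - Ψ) z = compSqrt Φ z - compSqrt Ψ z := rfl
    rw [h1, compSqrt_simple (fun _ _ _ => rfl), Fintype.sum_prod_type]
    congr 1
    refine Finset.sum_congr rfl fun i _ => ?_
    rw [Finset.sum_eq_single i]
    · simp [hBe i]
    · intro j _ hj
      simp [Ne.symm hj]
    · simp

end Integrands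

end CylInt

end

theorem mainTheorem10
    {Ω : Type*} [mΩ : MeasurableSpace Ω] (P : Measure Ω) [IsProbabilityMeasure P]
    (𝓕 : Filtration ℝ≥0 mΩ) (h𝓕 : CylInt.UsualConditions P 𝓕)
    {U : Type*} [TopologicalSpace U] [T2Space U] [MeasurableSpace U] [BorelSpace U]
    [StandardBorelSpace U]
    (𝒜 : Set (Set U)) (h𝒜 : IsSetRing 𝒜) (h𝒜' : ∀ A ∈ 𝒜, MeasurableSet A)
    {H : Type*} [NormedAddCommGroup H] [InnerProductSpace ℝ H] [CompleteSpace H]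
    [TopologicalSpace.SeparableSpace H]
    {G : Type*} [NormedAddCommGroup G] [InnerProductSpace ℝ G] [CompleteSpace G]
    [TopologicalSpace.SeparableSpace G]
    -- a cylindrical orthogonal martingale-valued measure and its intensity measures
    (M : ℝ≥0 → Set U → H → Ω → ℝ) (hM : CylInt.IsCylOrthMVM P 𝓕 𝒜 M)
    (ν : H → Kernel Ω (ℝ≥0 × U)) (hν : ∀ x, CylInt.IsIntensityMeasure P 𝓕 𝒜 M x (ν x))
    (hνb : CylInt.SequentiallyBounded P 𝒜 ν)
    -- its unique quadratic variation, with bounded range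
    (η : Kernel Ω (ℝ≥0 × U)) (hη : CylInt.IsQuadraticVariation P 𝒜 ν η)
    (hηu : ∀ η' : Kernel Ω (ℝ≥0 × U), CylInt.IsQuadraticVariation P 𝒜 ν η' → ∀ᵐ ω ∂P, η' ω = η ω)
    (T : ℝ≥0) (hT : 0 < T)
    (hηb : ∀ᵐ ω ∂P, (⨆ A ∈ 𝒜, η ω (Icc 0 T ×ˢ A)) < ∞)
    -- its quadratic variation operator measure, and the density of the latter
    (Γ : Ω → VectorMeasure (Icc 0 T × U) (H →L[ℝ] H)) (hΓ : CylInt.IsOperatorMeasure P T ν Γ)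
    (Q : Ω → Icc 0 T → U → H →L[ℝ] H) (hQ : CylInt.IsOperatorDensity P 𝓕 T η Γ Q) :
    (∀ Ψ : CylInt.Family Q G, CylInt.IsSimple 𝓕 𝒜 Ψ → CylInt.MemLambda P 𝓕 η Ψ) ∧
    ∀ Φ : CylInt.Family Q G, CylInt.MemLambda P 𝓕 η Φ → ∀ ε : ℝ≥0∞, 0 < ε →
      ∃ Ψ : CylInt.Family Q G, CylInt.IsSimple 𝓕 𝒜 Ψ ∧ CylInt.lambdaNorm P 𝓕 η (Φ - Ψ) < ε := by
  exact ⟨fun Ψ hΨ => hΨ.memLambda hM h𝒜' hν hΓ hQ,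
    fun Φ hΦ ε hε => CylInt.exists_isSimple_lt hM h𝒜' hν hΓ hQ hT hΦ hε⟩
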